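/- Let $f=(f_1,f_2):\mathbb{C}^2\to\mathbb{C}^2$ be a dominant polynomial map (its image is Zariski dense) with $f(0,0)\in(\mathbb{C}^*)^2$. Let $A_i\subset\mathbb{R}^2$ be the Newton polygon of $f_i$ (the convex hull of its support), let $A=A_1\oplus A_2$ be the Minkowski sum, and let $\Gamma$ be an edge of $A$. *Toric transformation.* Let $a$ be a vertex of $\Gamma$ closest to the origin, let $v\in\mathbb{Z}^2$ be the primitive vector pointing from $a$ along $\Gamma$, and let $w\in\mathbb{Z}^2$ be such that $(v,w)$ is a basis of $\mathbb{Z}^2$ and $A-a\subset\{b_1v+b_2w : b_1,b_2\ge 0\}$. Let $U\in \mathrm{GL}(2,\mathbb{Z})$ be the matrix with $Uv=(1,0)$ and $Uw=(0,1)$ (any such $U$ is called a $\Gamma$-toric transformation). For $y\in\mathbb{C}^2$ let $\overline{U}(f-y)$ be the pair of polynomials in $\mathbb{C}[z_1,z_2]$ obtained from $(f_1-y_1,f_2-y_2)$ by replacing every monomial $x^{\alpha}$ by $z^{U\alpha}$ and multiplying the $i$-th entry by the monomial $z^{m_i}$, $m_i\in\mathbb{Z}^2$, that clears denominators minimally for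 $f_i$, i.e. $(m_i)_j=-\min\{(U\alpha)_j:\alpha\in\operatorname{supp} f_i\}$; so $m_i$ does not depend on $y$. *Solutions and multiplicities.* Let $\mathrm{Sol}_{\mathbb{C}}(\Gamma)$ be the set of $\rho\in\mathbb{C}$ such that $(\rho,0)$ is a solution of $\overline{U}(f-y)=0$ for some $y\in\mathbb{C}^2$. For $\rho\in\mathbb{C}$ and $y\in\mathbb{C}^2$ let $\mu_\rho(y)\in\mathbb{N}\cup\{\infty\}$ be the multiplicity of $(\rho,0)$ as a solution of $\overline{U}(f-y)=0$, i.e. the complex dimension of the quotient of the local ring of $\mathbb{C}^2$ at $(\rho,0)$ by the ideal generated by the two polynomials ($0$ if $(\rho,0)$ is not a solution, $\infty$ if it is a non-isolated solution). *Multiplicity sets.* The topological face multiplicity set $\mathrm{TF}^{\rho}_{\mathbb{C}}(\Gamma)$ is the Euclidean closure of the set of all $y\in\mathbb{C}^2$ such that $\overline{U}(f-y)(\rho,0)=0$ and there are sequences $\varrho_k\in(\mathbb{C}^*)^2$, $y_k\in\mathbb{C}^2$ with $\varrho_k\to(\rho,0)$, $y_k\to y$ and $\overline{U}(f-y_k)(\varrho_k)=0$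 for all $k$. The algebraic face multiplicity set $\mathrm{AF}^{\rho}_{\mathbb{C}}(\Gamma)$ is the set of all $y\in\mathbb{C}^2$ at which $\mu_\rho$ is higher than its smallest (generic) value, i.e. $\mathrm{AF}^{\rho}_{\mathbb{C}}(\Gamma)=\{y : \mu_\rho(y)>\min_{q\in\mathbb{C}^2}\mu_\rho(q)\}$; equivalently, the largest proper subset of $\mathbb{C}^2$ consisting exactly of those $y$ whose multiplicity $\mu_\rho(y)$ is higher than $\mu_\rho(q)$ for every $q$ outside it. **Proposition.** For every edge $\Gamma$ of $A$, every $\Gamma$-toric transformation $U$ and every $\rho\in\mathrm{Sol}_{\mathbb{C}}(\Gamma)$, $$\mathrm{TF}^{\rho}_{\mathbb{C}}(\Gamma)=\mathrm{AF}^{\rho}_{\mathbb{C}}(\Gamma).$$ -/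

import Mathlib

open MvPolynomial Filter Topology
open scoped Pointwise Matrix

noncomputable section

/-! ### Newton polygons, faces, edges -/

/-- The Newton polygon of a polynomial in two variables: the convex hull of its support. -/
def newtonPolygon (p : MvPolynomial (Fin 2) ℂ) : Set (Fin 2 → ℝ) :=
  convexHull ℝ ((fun (a : Fin 2 →₀ ℕ) (j : Fin 2) => (a j : ℝ)) '' (p.support : Set (Fin 2 →₀ ℕ)))

/-- The Newton polygon of a pair: the Minkowski sum of the two Newton polygons. -/
def newtonSum (f : Fin 2 → MvPolynomial (Fin 2) ℂ) : Set (Fin 2 → ℝ) :=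
  newtonPolygon (f 0) + newtonPolygon (f 1)

/-- `Γ` is the face of `Δ` supported by some (inner normal) vector `α ≠ 0`. -/
def IsFace (Γ Δ : Set (Fin 2 → ℝ)) : Prop :=
  ∃ α : Fin 2 → ℝ, α ≠ 0 ∧ Γ = {x ∈ Δ | ∀ x' ∈ Δ, α ⬝ᵥ x ≤ α ⬝ᵥ x'}

/-- An edge is a face of dimension one. -/
def IsEdge (Γ Δ : Set (Fin 2 → ℝ)) : Prop :=
  IsFace Γ Δ ∧ Module.finrank ℝ (vectorSpan ℝ Γ) = 1

/-! ### Toric transformations attached to an edge -/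

/-- An integer vector seen as a real vector. -/
def toReal (a : Fin 2 → ℤ) : Fin 2 → ℝ := fun j => (a j : ℝ)

/-- `a` is a vertex of `Γ` closest to the origin, `v` is the primitive vector that points from `a`
along `Γ`, the pair `(v, w)` is a basis of `ℤ²`, and `A - a` lies in the cone spanned by `v, w`. -/
structure IsToricFrame (A Γ : Set (Fin 2 → ℝ)) (a v w : Fin 2 → ℤ) : Prop where
  vertex : toReal a ∈ Γ.extremePoints ℝ
  closest : ∀ b ∈ Γ.extremePoints ℝ, toReal a ⬝ᵥ toReal a ≤ b ⬝ᵥ b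
  primitive : IsCoprime (v 0) (v 1)
  along : ∃ t : ℝ, 0 < t ∧ toReal a + t • toReal v ∈ Γ
  basis : IsUnit (Matrix.of ![v, w]).det
  cone : ∀ x ∈ A, ∃ b₁ b₂ : ℝ, 0 ≤ b₁ ∧ 0 ≤ b₂ ∧ x - toReal a = b₁ • toReal v + b₂ • toReal w

/-- The `Γ`-toric transformations: the unimodular integer matrices `U = T⁻ᵀ`, where `T` has rows
`v` and `w`; that is, `U` sends `v` and `w` to the standard basis vectors. -/
def toricTransformations (A Γ : Set (Fin 2 → ℝ)) : Set (Matrix (Fin 2) (Fin 2) ℤ) :=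
  {U | ∃ a v w : Fin 2 → ℤ, IsToricFrame A Γ a v w ∧ U = ((Matrix.of ![v, w])⁻¹)ᵀ}

/-- The exponent `U a` of the monomial in `z` that is the image of `x ^ a`. -/
def toricExp (U : Matrix (Fin 2) (Fin 2) ℤ) (a : Fin 2 →₀ ℕ) : Fin 2 → ℤ :=
  U *ᵥ fun j => (a j : ℤ)

/-- The smallest exponent of `z j` in the Laurent polynomial `U p`. -/
def minExp (U : Matrix (Fin 2) (Fin 2) ℤ) (p : MvPolynomial (Fin 2) ℂ) (j : Fin 2) : ℤ :=
  sInf ((fun a => toricExp U a j) '' (p.support : Set (Fin 2 →₀ ℕ)))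

/-- The polynomial `Ū (p - c)` in `z`: every monomial `x ^ a` of `p - c` is replaced by `z ^ (U a)`,
and denominators are cleared by the smallest monomial that does so for `p`. This monomial does not
depend on `c`. For `p` with non-zero constant term, all the exponents below are non-negative before
`Int.toNat` is applied (see `toricExp_sub_minExp_nonneg` and `eval_toricTransform`). -/
def toricTransform (U : Matrix (Fin 2) (Fin 2) ℤ) (p : MvPolynomial (Fin 2) ℂ) (c : ℂ) :
    MvPolynomial (Fin 2) ℂ :=
  ∑ a ∈ (p - C c).support,
    monomial (Finsupp.equivFunOnFinite.symm fun j => (toricExp U a j - minExp U p j).toNat)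
      (coeff a (p - C c))

theorem toricExp_sub_minExp_nonneg (U : Matrix (Fin 2) (Fin 2) ℤ) (p : MvPolynomial (Fin 2) ℂ)
    (hp : eval 0 p ≠ 0) (c : ℂ) (a : Fin 2 →₀ ℕ) (ha : a ∈ (p - C c).support) (j : Fin 2) :
    0 ≤ toricExp U a j - minExp U p j := by
  have hap : a ∈ p.support := by
    by_cases h : a = 0
    · subst h
      have h2 : constantCoeff p ≠ 0 := by
        simpa [MvPolynomial.eval_zero] using hp
      simpa [MvPolynomial.mem_support_iff, constantCoeff_eq] using h2
    · rw [MvPolynomial.mem_support_iff] at ha ⊢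
      simpa [coeff_C, Ne.symm h] using ha
  have hfin : ((fun a => toricExp U a j) '' (p.support : Set (Fin 2 →₀ ℕ))).Finite :=
    (Finset.finite_toSet _).image _
  have : minExp U p j ≤ toricExp U a j :=
    csInf_le hfin.bddBelow ⟨a, hap, rfl⟩
  linarith

/-- On the torus, `Ū (p - c)` is `p - c` after the change of variables
`x j = z 0 ^ U 0 j * z 1 ^ U 1 j`, times a monomial. -/
theorem eval_toricTransform (U : Matrix (Fin 2) (Fin 2) ℤ) (p : MvPolynomial (Fin 2) ℂ)
    (hp : eval 0 p ≠ 0) (c : ℂ) (z : Fin 2 → ℂ) (hz : ∀ i, z i ≠ 0) :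
    eval z (toricTransform U p c) =
      z 0 ^ (-minExp U p 0) * z 1 ^ (-minExp U p 1) *
        (eval (fun j => z 0 ^ U 0 j * z 1 ^ U 1 j) p - c) := by
  have h1 : eval (fun j => z 0 ^ U 0 j * z 1 ^ U 1 j) p - c
      = eval (fun j => z 0 ^ U 0 j * z 1 ^ U 1 j) (p - C c) := by simp
  rw [h1, MvPolynomial.eval_eq' _ (p - C c), toricTransform, map_sum, Finset.mul_sum]
  refine Finset.sum_congr rfl fun a ha => ?_
  have key : ∀ j, z j ^ (toricExp U a j - minExp U p j).toNat
      = z j ^ (toricExp U a j - minExp U p j) := fun j => by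
    rw [← zpow_natCast, Int.toNat_of_nonneg (toricExp_sub_minExp_nonneg U p hp c a ha j)]
  rw [eval_monomial, Finsupp.prod_fintype _ _ (by simp)]
  simp only [Fin.prod_univ_two, Finsupp.equivFunOnFinite_symm_apply_apply, key]
  have h0 := hz 0
  have h1 := hz 1
  simp only [toricExp, Matrix.mulVec, dotProduct, Fin.sum_univ_two, ← zpow_natCast,
    mul_zpow, ← zpow_mul, sub_eq_add_neg, zpow_add₀ h0, zpow_add₀ h1]
  ring

/-! ### Multiplicity sets -/

/-- The map `ℂ² → ℂ²` given by `f` is dominant: its image is Zariski dense. -/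
def IsDominant (f : Fin 2 → MvPolynomial (Fin 2) ℂ) : Prop :=
  ∀ P : MvPolynomial (Fin 2) ℂ, (∀ x : Fin 2 → ℂ, eval (fun i => eval x (f i)) P = 0) → P = 0

/-- `z` is a solution of the system `Ū (f - y) = 0`. -/
def IsSol (f : Fin 2 → MvPolynomial (Fin 2) ℂ) (U : Matrix (Fin 2) (Fin 2) ℤ)
    (y z : Fin 2 → ℂ) : Prop :=
  ∀ i, eval z (toricTransform U (f i) (y i)) = 0

/-- The (maximal) ideal of the point `z` of `ℂ²`. -/
def pointIdeal (z : Fin 2 → ℂ) : Ideal (MvPolynomial (Fin 2) ℂ) := RingHom.ker (eval z)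

instance (z : Fin 2 → ℂ) : (pointIdeal z).IsPrime := RingHom.ker_isPrime _

/-- The multiplicity of `z` as a solution of `g 0 = g 1 = 0`: the complex dimension of the quotient
of the local ring of `ℂ²` at `z` by the ideal generated by `g 0` and `g 1`. It is `0` if `z` is not
a solution, and `⊤` if `z` is a solution that is not isolated. -/
def multiplicityAt (g : Fin 2 → MvPolynomial (Fin 2) ℂ) (z : Fin 2 → ℂ) : ℕ∞ :=
  Cardinal.toENat (Module.rank ℂ
    (Localization.AtPrime (pointIdeal z) ⧸
      (Ideal.span (Set.range g)).map
        (algebraMap (MvPolynomial (Fin 2) ℂ) (Localization.AtPrime (pointIdeal z)))))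

/-- The multiplicity of `(ρ, 0)` as a solution of `Ū (f - y) = 0`. -/
def faceMultiplicity (f : Fin 2 → MvPolynomial (Fin 2) ℂ) (U : Matrix (Fin 2) (Fin 2) ℤ) (ρ : ℂ)
    (y : Fin 2 → ℂ) : ℕ∞ :=
  multiplicityAt (fun i => toricTransform U (f i) (y i)) ![ρ, 0]

/-- The set of the `ρ` such that `(ρ, 0)` is a solution of `Ū (f - y) = 0` for some `y`. -/
def faceSol (f : Fin 2 → MvPolynomial (Fin 2) ℂ) (U : Matrix (Fin 2) (Fin 2) ℤ) : Set ℂ :=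
  {ρ | ∃ y : Fin 2 → ℂ, IsSol f U y ![ρ, 0]}

/-- The topological face multiplicity set at `ρ`. -/
def topFaceMult (f : Fin 2 → MvPolynomial (Fin 2) ℂ) (U : Matrix (Fin 2) (Fin 2) ℤ) (ρ : ℂ) :
    Set (Fin 2 → ℂ) :=
  closure {y | IsSol f U y ![ρ, 0] ∧
    ∃ (z : ℕ → Fin 2 → ℂ) (q : ℕ → Fin 2 → ℂ),
      (∀ k i, z k i ≠ 0) ∧ Tendsto z atTop (𝓝 ![ρ, 0]) ∧ Tendsto q atTop (𝓝 y) ∧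
        ∀ k, IsSol f U (q k) (z k)}

/-- The algebraic face multiplicity set at `ρ`: the `y` at which the multiplicity of `(ρ, 0)` is
higher than its smallest (which is also its generic) value. -/
def algFaceMult (f : Fin 2 → MvPolynomial (Fin 2) ℂ) (U : Matrix (Fin 2) (Fin 2) ℤ) (ρ : ℂ) :
    Set (Fin 2 → ℂ) :=
  {y | ∃ q, faceMultiplicity f U ρ q < faceMultiplicity f U ρ y}

/-- The algebraic face multiplicity set consists of the points whose multiplicity is higher than
that of every point outside it; it is the largest proper subset of `ℂ²` with this property. -/
theorem algFaceMult_spec (f : Fin 2 → MvPolynomial (Fin 2) ℂ) (U : Matrix (Fin 2) (Fin 2) ℤ)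
    (ρ : ℂ) :
    IsGreatest {S : Set (Fin 2 → ℂ) | S ≠ Set.univ ∧
      ∀ y, y ∈ S ↔ ∀ q, q ∉ S → faceMultiplicity f U ρ q < faceMultiplicity f U ρ y}
      (algFaceMult f U ρ) := by
  obtain ⟨m, hm⟩ : ∃ m, ∀ q, faceMultiplicity f U ρ m ≤ faceMultiplicity f U ρ q := by
    obtain ⟨_, ⟨m, rfl⟩, h⟩ := (wellFounded_lt (α := ℕ∞)).has_min
      (Set.range (faceMultiplicity f U ρ)) (Set.range_nonempty _)
    exact ⟨m, fun q => not_lt.mp (h _ ⟨q, rfl⟩)⟩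
  have hmA : m ∉ algFaceMult f U ρ := fun ⟨q, hq⟩ => absurd hq (not_lt.mpr (hm q))
  refine ⟨⟨fun h => hmA (h ▸ Set.mem_univ m), fun y => ⟨?_, fun h => ⟨m, h m hmA⟩⟩⟩, ?_⟩
  · rintro ⟨q, hq⟩ q' hq'
    by_contra hcon
    exact hq' ⟨q, lt_of_lt_of_le hq (not_lt.mp hcon)⟩
  · rintro S ⟨hS, h⟩ y hy
    obtain ⟨q, hq⟩ := (Set.ne_univ_iff_exists_notMem S).mp hS
    exact ⟨q, (h y).mp hy q hq⟩

end

noncomputable section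

open scoped ContDiff

/-! The constant `y i` enters `Ū (f - y)` affinely: the system is `G i - y i * z ^ M i`, where `M i`
is the image of the exponent `0`. The cone condition on the frame makes both coordinates of `U`
minimal at one and the same support point, so `G i` has a non-zero constant term.

If no `M i` involves `z 1`, neither monomial vanishes at `(ρ, 0)`. Then `(ρ, 0)` solves the system
for exactly one `y`, and both sets equal that singleton
(`closure_limit_eq_multiplicity_jump_of_forall_eq_zero`).

Otherwise some `M i` involves `z 1`. On the line `z 1 = 0` the `i`-th polynomial is then a non-zero
polynomial independent of `y`, it vanishes at `ρ`, and `ρ ≠ 0`. So near `(ρ, 0)` it has a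
Weierstrass factor, monic of constant degree in `s = z 0 - ρ`, whose coefficients are analytic in
`(y, t)`, `t = z 1`, near every `(y, 0)` (`exists_analytic_factorization`). Let `D y t` be the
resultant in `s` of this factor and the other polynomial (`exists_resultant_family`). The order of
`D y` at `t = 0` is the multiplicity of `(ρ, 0)` (`multiplicityAt_eq_analyticOrderAt`), and the
zeros of `D` near `(y, 0)` are the pairs `(y', t)` for which the system of `y'` has a solution near
`(ρ, 0)` with `z 1 = t`.

Let `c` be the least order. It is finite by `exists_analyticOrderAt_ne_top`, and `D y t = a y * t ^
c + O(t ^ (c + 1))` locally uniformly in `y`, with `a` continuous and entire on complex lines. The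
multiplicity jumps exactly where `a = 0`. Zeros `(q k, t k)` of `D` with `t k ≠ 0` converging to
`(y, 0)` force `a y = 0` (`mem_orderJump_of_tendsto`). Conversely, if `a y = 0`, a Rouché-type
argument on a line where `a` is not identically zero yields zeros of `D` with `t ≠ 0` arbitrarily
close to `(y, 0)` (`exists_zero_of_mem_orderJump`). -/

/-! ### Linear algebra over `K[X]`: truncated cokernels and orders of determinants. -/

/-- A divisor of `X ^ N` is associated to a power of `X`, so the gcd is `X ^ k` with `k` the smaller
of `N` and the order of `a` at `0`. -/
theorem Polynomial.exists_X_pow_gcd {K : Type*} [Field K] (a : Polynomial K) (N : ℕ) :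
    ∃ k ≤ N, (∀ p : Polynomial K, (∃ u v, p = a * u + Polynomial.X ^ N * v) ↔
      Polynomial.X ^ k ∣ p) ∧ Polynomial.X ^ k ∣ a ∧
      (k < N → ¬ Polynomial.X ^ (k + 1) ∣ a) := by
  classical
  obtain ⟨k, hk, hak⟩ := (dvd_prime_pow (Polynomial.prime_X (R := K)) N).1
    (EuclideanDomain.gcd_dvd_right a (Polynomial.X ^ N))
  have hk' : ∀ p : Polynomial K, (∃ u v, p = a * u + Polynomial.X ^ N * v) ↔
      Polynomial.X ^ k ∣ p := by
    intro p
    rw [← hak.dvd_iff_dvd_left]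
    constructor
    · rintro ⟨u, v, rfl⟩
      exact dvd_add ((EuclideanDomain.gcd_dvd_left _ _).mul_right _)
        ((EuclideanDomain.gcd_dvd_right _ _).mul_right _)
    · rintro ⟨c, rfl⟩
      refine ⟨EuclideanDomain.gcdA a (Polynomial.X ^ N) * c,
        EuclideanDomain.gcdB a (Polynomial.X ^ N) * c, ?_⟩
      conv_lhs => rw [EuclideanDomain.gcd_eq_gcd_ab]
      ring
  refine ⟨k, hk, hk', (hk' a).1 ⟨1, 0, by ring⟩, fun hlt hdvd => ?_⟩
  obtain ⟨u, v, huv⟩ := (hk' (Polynomial.X ^ k)).2 dvd_rfl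
  have h1 : (Polynomial.X : Polynomial K) ^ (k + 1) ∣ Polynomial.X ^ k := by
    rw [huv]
    exact dvd_add (hdvd.mul_right _) ((pow_dvd_pow _ hlt).mul_right _)
  rw [pow_dvd_pow_iff Polynomial.X_ne_zero Polynomial.not_isUnit_X] at h1
  omega

theorem Module.Basis.repr_equivFun_symm {R ι M : Type*} [CommSemiring R] [Finite ι]
    [AddCommMonoid M] [Module R M] (b : Module.Basis ι R M) (c : ι → R) (i : ι) :
    b.repr (b.equivFun.symm c) i = c i := by
  rw [← b.equivFun_apply, LinearEquiv.apply_symm_apply]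

/-- Smith normal form of the image of a linear map, as divisibility of coordinates; the product of
the invariants is the determinant. -/
theorem LinearMap.exists_basis_range_dvd {R ι M₁ M₂ : Type*} [CommRing R] [IsDomain R]
    [IsPrincipalIdealRing R] [Fintype ι] [DecidableEq ι] [AddCommGroup M₁] [Module R M₁]
    [AddCommGroup M₂] [Module R M₂] (b₁ : Module.Basis ι R M₁) (b₂ : Module.Basis ι R M₂)
    (L : M₁ →ₗ[R] M₂) :
    ∃ (b : Module.Basis ι R M₂) (a : ι → R), (∀ x, x ∈ LinearMap.range L ↔ ∀ i, a i ∣ b.repr x i) ∧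
      Associated (LinearMap.toMatrix b₁ b₂ L).det (∏ i, a i) := by
  obtain ⟨n, b, bN, f, a, snf⟩ := (LinearMap.range L).smithNormalForm b₂
  -- The image may have smaller rank than the target. The missing invariants are set to `0`, and
  -- divisibility by `0` makes the corresponding coordinate vanish.
  let a' : ι → R := Function.extend f a 0
  let D : M₂ →ₗ[R] M₂ := b.constr R fun i => a' i • b i
  have hDb : ∀ i, D (b i) = a' i • b i := fun i => by simp [D]
  have hD : ∀ x i, b.repr (D x) i = a' i * b.repr x i := by
    intro x i
    conv_lhs => rw [← b.sum_repr x]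
    simp only [map_sum, map_smul, hDb, Finsupp.coe_finsetSum, Finset.sum_apply, Finsupp.smul_apply,
      b.repr_self, smul_eq_mul]
    rw [Finset.sum_eq_single i (fun j _ hj => by simp [hj]) (by simp)]
    simp [mul_comm]
  have hmem : ∀ x, x ∈ LinearMap.range D ↔ ∀ i, a' i ∣ b.repr x i := by
    intro x
    constructor
    · rintro ⟨y, rfl⟩ i
      exact ⟨_, hD y i⟩
    · intro h
      choose c hc using h
      refine ⟨b.equivFun.symm c, b.repr.injective (Finsupp.ext fun i => ?_)⟩
      rw [hD, hc, b.repr_equivFun_symm]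
  have hrange : LinearMap.range D = LinearMap.range L := by
    apply le_antisymm
    · rw [LinearMap.range_eq_map, ← b.span_eq, Submodule.map_span, Submodule.span_le]
      rintro _ ⟨_, ⟨i, rfl⟩, rfl⟩
      rw [hDb]
      by_cases hi : ∃ j, f j = i
      · obtain ⟨j, rfl⟩ := hi
        simp only [a', f.injective.extend_apply, ← snf]
        exact (bN j).2
      · simp only [a', Function.extend_apply' _ _ _ hi]
        simp
    · intro x hx
      have : x = ∑ j, bN.repr ⟨x, hx⟩ j • (bN j : M₂) := by
        have := congrArg Subtype.val (bN.sum_repr ⟨x, hx⟩)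
        rw [Submodule.coe_sum] at this
        exact this.symm
      rw [this]
      refine Submodule.sum_mem _ fun j _ => Submodule.smul_mem _ _ ⟨b (f j), ?_⟩
      rw [hDb, snf]
      simp [a', f.injective.extend_apply]
  refine ⟨b, a', fun x => hrange ▸ hmem x, ?_⟩
  have hdet : (LinearMap.toMatrix b₂ b₂ D).det = ∏ i, a' i := by
    rw [LinearMap.det_toMatrix, ← LinearMap.det_toMatrix b, ← Matrix.det_diagonal]
    congr 1
    ext i j
    rw [LinearMap.toMatrix_apply, hD, Matrix.diagonal_apply]
    by_cases h : i = j
    · subst h; simp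
    · simp [h]
  have h1 : ∀ i, ∃ y, D y = L (b₁ i) := fun i => by
    have : L (b₁ i) ∈ LinearMap.range D := hrange ▸ ⟨_, rfl⟩
    exact this
  have h2 : ∀ i, ∃ y, L y = D (b₂ i) := fun i => by
    have : D (b₂ i) ∈ LinearMap.range L := hrange ▸ ⟨_, rfl⟩
    exact this
  choose e he using h1
  choose e' he' using h2
  -- Equal images of free modules: each map factors through the other, so the determinants divide
  -- one another.
  have hL : L = D ∘ₗ b₁.constr R e := b₁.ext fun i => by simp [he]
  have hD' : D = L ∘ₗ b₂.constr R e' := b₂.ext fun i => by simp [he']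
  refine associated_of_dvd_dvd ?_ ?_
  · rw [← hdet]
    conv_rhs => rw [hD', LinearMap.toMatrix_comp b₂ b₁ b₂, Matrix.det_mul]
    exact dvd_mul_right _ _
  · rw [← hdet]
    conv_rhs => rw [hL, LinearMap.toMatrix_comp b₁ b₂ b₂, Matrix.det_mul]
    exact dvd_mul_right _ _

/-- Coordinates on the cokernel, truncated at order `N`, of a linear map between free `K[X]`-modules
of the same rank; the dimension is the order of the determinant when this is at most `N`. -/
theorem LinearMap.exists_coker_coordinates {K ι M₁ M₂ : Type*} [Field K] [Fintype ι] [DecidableEq ι]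
    [AddCommGroup M₁] [Module (Polynomial K) M₁] [AddCommGroup M₂] [Module (Polynomial K) M₂]
    [Module K M₂] [IsScalarTower K (Polynomial K) M₂]
    (b₁ : Module.Basis ι (Polynomial K) M₁) (b₂ : Module.Basis ι (Polynomial K) M₂)
    (L : M₁ →ₗ[Polynomial K] M₂) (N : ℕ) :
    ∃ (s : ℕ) (Λ : M₂ →ₗ[K] (Fin s → K)), Function.Surjective Λ ∧
      (∀ x, Λ x = 0 ↔ ∃ u v, x = L u + (Polynomial.X ^ N : Polynomial K) • v) ∧
      Polynomial.X ^ s ∣ (LinearMap.toMatrix b₁ b₂ L).det ∧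
      (s < N → ¬ Polynomial.X ^ (s + 1) ∣ (LinearMap.toMatrix b₁ b₂ L).det) := by
  obtain ⟨b, a, hrange, hdet⟩ := LinearMap.exists_basis_range_dvd b₁ b₂ L
  choose k hkN hk hka hka' using fun i => Polynomial.exists_X_pow_gcd (a i) N
  -- In the Smith basis the truncated cokernel is the direct sum of the `K[X] ⧸ X ^ k i`; its
  -- coordinates are the coefficients of index below `k i`.
  let Λ₀ : M₂ →ₗ[K] ((Σ i, Fin (k i)) → K) :=
    { toFun := fun x p => (b.repr x p.1).coeff p.2
      map_add' := fun x y => by ext p; simp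
      map_smul' := fun c x => by
        ext p
        rw [← algebraMap_smul (Polynomial K) c x]
        simp }
  have hcard : Fintype.card (Σ i, Fin (k i)) = ∑ i, k i := by simp
  let e : (Σ i, Fin (k i)) ≃ Fin (∑ i, k i) := Fintype.equivFinOfCardEq hcard
  have hpow : (Polynomial.X : Polynomial K) ^ (∑ i, k i) = ∏ i, Polynomial.X ^ k i :=
    (Finset.prod_pow_eq_pow_sum _ _ _).symm
  refine ⟨∑ i, k i, (LinearEquiv.funCongrLeft K K e.symm).toLinearMap ∘ₗ Λ₀, ?_, ?_, ?_, ?_⟩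
  · rw [LinearMap.coe_comp]
    refine (LinearEquiv.funCongrLeft K K e.symm).surjective.comp fun c => ?_
    refine ⟨b.equivFun.symm fun i => ∑ j : Fin (k i), Polynomial.monomial j (c ⟨i, j⟩), ?_⟩
    ext ⟨i, j⟩
    simp only [Λ₀, LinearMap.coe_mk, AddHom.coe_mk, b.repr_equivFun_symm]
    simp [Polynomial.finsetSum_coeff, Polynomial.coeff_monomial, Fin.val_inj]
  · intro x
    rw [LinearMap.comp_apply, LinearEquiv.coe_coe, LinearEquiv.map_eq_zero_iff]
    have h1 : Λ₀ x = 0 ↔ ∀ i, (Polynomial.X : Polynomial K) ^ k i ∣ b.repr x i := by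
      simp only [Polynomial.X_pow_dvd_iff]
      exact ⟨fun h i d hd => congrFun h ⟨i, d, hd⟩, fun h => funext fun p => h p.1 p.2 p.2.2⟩
    rw [h1]
    constructor
    · intro h
      choose u v huv using fun i => (hk i _).2 (h i)
      obtain ⟨y, hy⟩ := (hrange (b.equivFun.symm fun i => a i * u i)).2 fun i => by
        rw [b.repr_equivFun_symm]; exact dvd_mul_right _ _
      refine ⟨y, b.equivFun.symm v, b.repr.injective (Finsupp.ext fun i => ?_)⟩
      rw [huv, hy, map_add, Finsupp.add_apply, map_smul, Finsupp.smul_apply, b.repr_equivFun_symm,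
        b.repr_equivFun_symm, smul_eq_mul]
    · rintro ⟨u, v, rfl⟩ i
      obtain ⟨c, hc⟩ := (hrange (L u)).1 ⟨u, rfl⟩ i
      exact (hk i _).1 ⟨c, b.repr v i, by simp [hc]⟩
  · rw [hdet.dvd_iff_dvd_right, hpow]
    exact Finset.prod_dvd_prod_of_dvd _ _ fun i _ => hka i
  · intro hlt hdvd
    -- When the total is below `N`, no invariant has been truncated, so each `k i` is the exact
    -- order of `a i`.
    have hlt' : ∀ i, k i < N := fun i =>
      (Finset.single_le_sum (fun _ _ => Nat.zero_le _) (Finset.mem_univ i)).trans_lt hlt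
    choose h hh using hka
    rw [hdet.dvd_iff_dvd_right, Finset.prod_congr rfl fun i _ => hh i, Finset.prod_mul_distrib,
      ← hpow, pow_succ, mul_dvd_mul_iff_left (pow_ne_zero _ Polynomial.X_ne_zero),
      Polynomial.prime_X.dvd_finsetProd_iff] at hdvd
    obtain ⟨i, -, c, hc⟩ := hdvd
    exact hka' i (hlt' i) ⟨c, by rw [hh i, hc]; ring⟩

theorem Polynomial.divByMonic_mem_degreeLT {R : Type*} [CommRing R] [Nontrivial R]
    {P z : Polynomial R} (hP : P.Monic) {n : ℕ}
    (hz : z ∈ Polynomial.degreeLT R (P.natDegree + n)) : z /ₘ P ∈ Polynomial.degreeLT R n := by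
  rw [Polynomial.mem_degreeLT] at hz ⊢
  by_cases h : P.degree ≤ z.degree
  · have h1 := Polynomial.degree_add_divByMonic hP h
    rw [← h1, Polynomial.degree_eq_natDegree hP.ne_zero, Nat.cast_add] at hz
    exact lt_of_add_lt_add_left hz
  · rw [(Polynomial.divByMonic_eq_zero_iff hP).2 (not_le.1 h)]
    simp

/-- Coordinates on `K[X][Y] ⧸ (P, g, X ^ N)` for `P` monic in `Y`. -/
theorem Polynomial.exists_quotient_coordinates {K : Type*} [Field K]
    (P g : Polynomial (Polynomial K)) (hP : P.Monic) {n : ℕ} (hg : g.natDegree ≤ n) (N : ℕ) :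
    ∃ (s : ℕ) (Λ : Polynomial (Polynomial K) →ₗ[K] (Fin s → K)), Function.Surjective Λ ∧
      (∀ x, Λ x = 0 ↔ ∃ a b c, x = P * a + g * b + Polynomial.C (Polynomial.X ^ N) * c) ∧
      Polynomial.X ^ s ∣ Polynomial.resultant P g P.natDegree n ∧
      (s < N → ¬ Polynomial.X ^ (s + 1) ∣ Polynomial.resultant P g P.natDegree n) := by
  obtain ⟨s, Λ, hsurj, hker, hs, hs'⟩ := LinearMap.exists_coker_coordinates
    (((Polynomial.degreeLT.basis (Polynomial K) P.natDegree).prod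
      (Polynomial.degreeLT.basis (Polynomial K) n)).reindex finSumFinEquiv)
    (Polynomial.degreeLT.basis (Polynomial K) (P.natDegree + n))
    (Polynomial.sylvesterMap P g le_rfl hg) N
  rw [Polynomial.toMatrix_sylvesterMap', ← Polynomial.resultant] at hs hs'
  have hlt : ∀ x : Polynomial (Polynomial K), (x %ₘ P) ∈
      Polynomial.degreeLT (Polynomial K) P.natDegree := fun x => by
    rw [Polynomial.mem_degreeLT, ← Polynomial.degree_eq_natDegree hP.ne_zero]
    exact Polynomial.degree_modByMonic_lt x hP
  have hle : Polynomial.degreeLT (Polynomial K) P.natDegree ≤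
      Polynomial.degreeLT (Polynomial K) (P.natDegree + n) :=
    Polynomial.degreeLT_mono (Nat.le_add_right _ _)
  -- Division with remainder by the monic `P` identifies `K[X][Y] ⧸ (P, g)` with the cokernel of the
  -- Sylvester map, whose determinant is the resultant.
  let M : Polynomial (Polynomial K) →ₗ[K] Polynomial.degreeLT (Polynomial K) (P.natDegree + n) :=
    ((Polynomial.modByMonicHom P).codRestrict _ fun x => hle (hlt x)).restrictScalars K
  have hM : ∀ x, (M x : Polynomial (Polynomial K)) = x %ₘ P := fun x => rfl
  refine ⟨s, Λ ∘ₗ M, ?_, ?_, hs, hs'⟩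
  · intro c
    obtain ⟨z, rfl⟩ := hsurj c
    refine ⟨z, ?_⟩
    rw [LinearMap.comp_apply, ← sub_eq_zero, ← map_sub, hker]
    refine ⟨(0, -⟨_, Polynomial.divByMonic_mem_degreeLT hP z.2⟩), 0, Subtype.ext ?_⟩
    have := Polynomial.modByMonic_add_div (z : Polynomial (Polynomial K)) P
    simp only [AddSubgroupClass.coe_sub, hM, Submodule.coe_add, Polynomial.sylvesterMap_apply_coe,
      Submodule.coe_neg, Submodule.coe_zero, smul_zero, mul_zero]
    linear_combination this
  · intro x
    rw [LinearMap.comp_apply, hker]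
    constructor
    · rintro ⟨u, v, huv⟩
      have h1 := congrArg Subtype.val huv
      simp only [hM, Submodule.coe_add, Polynomial.sylvesterMap_apply_coe, Submodule.coe_smul,
        Polynomial.smul_eq_C_mul] at h1
      refine ⟨u.2 + x /ₘ P, u.1, v, ?_⟩
      have := Polynomial.modByMonic_add_div x P
      linear_combination h1 - this
    · rintro ⟨a, b, c, rfl⟩
      have hgb : g * (b %ₘ P) ∈ Polynomial.degreeLT (Polynomial K) (P.natDegree + n) :=
        by simpa using (Polynomial.sylvesterMap P g le_rfl hg (⟨_, hlt b⟩, 0)).2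
      refine ⟨(⟨_, hlt b⟩, -⟨_, Polynomial.divByMonic_mem_degreeLT hP hgb⟩),
        ⟨_, hle (hlt c)⟩, Subtype.ext ?_⟩
      simp only [hM, Submodule.coe_add, Polynomial.sylvesterMap_apply_coe, Submodule.coe_smul,
        Submodule.coe_neg, Polynomial.smul_eq_C_mul, Polynomial.add_modByMonic]
      have h1 := Polynomial.modByMonic_add_div (g * (b %ₘ P)) P
      have h2 : (P * a) %ₘ P = 0 := (Polynomial.modByMonic_eq_zero_iff_dvd hP).2 (dvd_mul_right _ _)
      have h3 : (g * b) %ₘ P = (g * (b %ₘ P)) %ₘ P := by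
        have h4 := Polynomial.modByMonic_add_div b P
        have h5 : g * b = g * (b %ₘ P) + P * (g * (b /ₘ P)) := by linear_combination (-g) * h4
        rw [h5, Polynomial.add_modByMonic,
          (Polynomial.modByMonic_eq_zero_iff_dvd hP).2 (dvd_mul_right _ _), add_zero]
      have h6 : (Polynomial.C (Polynomial.X ^ N : Polynomial K) * c) %ₘ P =
          Polynomial.C (Polynomial.X ^ N) * (c %ₘ P) := by
        rw [← Polynomial.smul_eq_C_mul, Polynomial.smul_modByMonic, Polynomial.smul_eq_C_mul]
      rw [h2, h3, h6]
      linear_combination h1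

/-! ### Dimensions of local quotients in the plane, truncated by a power of `z 1`. -/

/-- The dimension of a quotient of a local ring, from coordinates on a quotient of the ring that
is already local. -/
theorem rank_localization_quotient_eq {K S : Type*} [Field K] [CommRing S] [Algebra K S]
    (m : Ideal S) [m.IsPrime] (I J : Ideal S) (hIJ : I ≤ J)
    (hJI : ∀ h ∈ J, ∃ w ∉ m, w * h ∈ I) (hunit : ∀ u ∉ m, ∃ v, u * v - 1 ∈ J) {s : ℕ}
    (Λ : S →ₗ[K] (Fin s → K)) (hΛ : Function.Surjective Λ) (hker : ∀ x, Λ x = 0 ↔ x ∈ J) :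
    Module.rank K (Localization.AtPrime m ⧸ I.map (algebraMap S (Localization.AtPrime m))) = s := by
  let I' := I.map (algebraMap S (Localization.AtPrime m))
  let Ψ : S →ₗ[K] (Localization.AtPrime m ⧸ I') :=
    ((Ideal.Quotient.mkₐ K I').comp
      (IsScalarTower.toAlgHom K S (Localization.AtPrime m))).toLinearMap
  have hΨ : ∀ x, Ψ x = Ideal.Quotient.mk I' (algebraMap S _ x) := fun x => rfl
  -- The contraction of the localized `I` is `J`: a multiplier outside `m` is invertible modulo `J`
  -- and can be cancelled.
  have hmem : ∀ x, Ψ x = 0 ↔ x ∈ J := by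
    intro x
    rw [hΨ, Ideal.Quotient.eq_zero_iff_mem,
      IsLocalization.algebraMap_mem_map_algebraMap_iff m.primeCompl]
    constructor
    · rintro ⟨w, hw, hwx⟩
      obtain ⟨v, hv⟩ := hunit w hw
      have h1 : x = v * (w * x) - (w * v - 1) * x := by ring
      rw [h1]
      exact J.sub_mem (J.mul_mem_left _ (hIJ hwx)) (J.mul_mem_right _ hv)
    · intro hx
      obtain ⟨w, hw, hwx⟩ := hJI x hx
      exact ⟨w, hw, hwx⟩
  have hsurj : Function.Surjective Ψ := by
    intro q
    obtain ⟨q, rfl⟩ := Ideal.Quotient.mk_surjective q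
    obtain ⟨h, u, rfl⟩ := IsLocalization.exists_mk'_eq m.primeCompl q
    obtain ⟨v, hv⟩ := hunit u u.2
    refine ⟨h * v, ?_⟩
    have h1 := (hmem _).2 hv
    rw [hΨ, Ideal.Quotient.eq_zero_iff_mem] at h1
    rw [hΨ, Ideal.Quotient.eq]
    have h2 : algebraMap S (Localization.AtPrime m) (h * v) - IsLocalization.mk' _ h u =
        IsLocalization.mk' _ h u * algebraMap S _ (u * v - 1) := by
      simp only [map_sub, map_mul, map_one]
      rw [mul_sub, mul_one, ← mul_assoc, IsLocalization.mk'_spec]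
    rw [h2]
    exact I'.mul_mem_left _ h1
  have hkk : LinearMap.ker Ψ = LinearMap.ker Λ := by
    ext x
    rw [LinearMap.mem_ker, LinearMap.mem_ker, hmem, hker]
  have e := ((Ψ.quotKerEquivOfSurjective hsurj).symm.trans
    (Submodule.quotEquivOfEq _ _ hkk)).trans (Λ.quotKerEquivOfSurjective hΛ)
  have := e.lift_rank_eq
  simpa using this

/-- Polynomials in `z 0, z 1` as polynomials in `Y = z 0 - ρ` over the polynomials in `X = z 1`. -/
def shiftEquiv (ρ : ℂ) : MvPolynomial (Fin 2) ℂ ≃ₐ[ℂ] Polynomial (Polynomial ℂ) :=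
  AlgEquiv.ofAlgHom
    (aeval ![Polynomial.X + Polynomial.C (Polynomial.C ρ), Polynomial.C Polynomial.X])
    (Polynomial.eval₂AlgHom (Polynomial.aeval (X 1)) (X 0 - C ρ) fun _ => Commute.all _ _)
    (by ext <;> simp [Polynomial.algebraMap_apply]) (by ext i; fin_cases i <;> simp)

theorem shiftEquiv_X_one (ρ : ℂ) : shiftEquiv ρ (X 1) = Polynomial.C Polynomial.X := by
  simp [shiftEquiv]

theorem eval_shiftEquiv (ρ s t : ℂ) (h : MvPolynomial (Fin 2) ℂ) :
    ((shiftEquiv ρ h).map (Polynomial.evalRingHom t)).eval s = eval ![s + ρ, t] h := by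
  have : ((Polynomial.evalRingHom s).comp (Polynomial.mapRingHom (Polynomial.evalRingHom t))).comp
      (shiftEquiv ρ : MvPolynomial (Fin 2) ℂ →+* Polynomial (Polynomial ℂ)) =
      eval ![s + ρ, t] := by
    ext i
    · simp [shiftEquiv, Polynomial.algebraMap_apply]
    · fin_cases i <;> simp [shiftEquiv]
  exact congrArg (fun φ => φ h) this

theorem coeff_zero_shiftEquiv (ρ : ℂ) (h : MvPolynomial (Fin 2) ℂ) :
    ((shiftEquiv ρ h).coeff 0).coeff 0 = eval ![ρ, 0] h := by
  have := eval_shiftEquiv ρ 0 0 h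
  rw [zero_add] at this
  rw [← this, ← Polynomial.coeff_zero_eq_eval_zero, Polynomial.coeff_map,
    Polynomial.coe_evalRingHom, Polynomial.coeff_zero_eq_eval_zero]

theorem mem_pointIdeal_iff (ρ : ℂ) (h : MvPolynomial (Fin 2) ℂ) :
    h ∈ pointIdeal ![ρ, 0] ↔ ((shiftEquiv ρ h).coeff 0).coeff 0 = 0 := by
  rw [coeff_zero_shiftEquiv]
  rfl

/-- A homomorphism under which both variables become nilpotent sends bivariate polynomials with
non-zero constant term to units. -/
theorem Polynomial.isUnit_map_of_monic {K T : Type*} [Field K] [CommRing T]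
    (φ : Polynomial (Polynomial K) →+* T) {N : ℕ} (P : Polynomial (Polynomial K))
    (hP : P.Monic) (hPX : ∀ i < P.natDegree, (P.coeff i).coeff 0 = 0) (hPφ : φ P = 0)
    (hX : φ (Polynomial.C (Polynomial.X ^ N)) = 0) (u : Polynomial (Polynomial K))
    (hu : (u.coeff 0).coeff 0 ≠ 0) : IsUnit (φ u) := by
  have hXn : IsNilpotent (φ (Polynomial.C Polynomial.X)) :=
    ⟨N, by rw [← map_pow, ← map_pow]; exact hX⟩
  have hC : ∀ p : Polynomial K, p.coeff 0 = 0 → IsNilpotent (φ (Polynomial.C p)) := by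
    intro p hp
    obtain ⟨q, rfl⟩ := Polynomial.X_dvd_iff.2 hp
    rw [map_mul, map_mul]
    exact (Commute.all _ _).isNilpotent_mul_right hXn
  -- The lower coefficients of `P` are divisible by `X`, so the relation `φ P = 0` writes a power of
  -- `Y` as a sum of nilpotents.
  have hYn : IsNilpotent (φ Polynomial.X) := by
    have h1 : IsNilpotent (φ (Polynomial.X ^ P.natDegree)) := by
      have h2 : (Polynomial.X : Polynomial (Polynomial K)) ^ P.natDegree = P -
          ∑ i ∈ Finset.range P.natDegree, Polynomial.C (P.coeff i) * Polynomial.X ^ i :=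
        eq_sub_of_add_eq hP.as_sum.symm
      rw [h2, map_sub, hPφ, zero_sub, isNilpotent_neg_iff, map_sum]
      refine isNilpotent_sum fun i hi => ?_
      rw [map_mul]
      exact (Commute.all _ _).isNilpotent_mul_right (hC _ (hPX i (Finset.mem_range.1 hi)))
    obtain ⟨k, hk⟩ := h1
    exact ⟨P.natDegree * k, by rw [pow_mul, ← map_pow, hk]⟩
  have h1 : u = Polynomial.C (Polynomial.C ((u.coeff 0).coeff 0)) +
      (Polynomial.C (u.coeff 0 - Polynomial.C ((u.coeff 0).coeff 0)) +
        Polynomial.X * u.divX) := by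
    conv_lhs => rw [← Polynomial.X_mul_divX_add u]
    rw [map_sub]
    ring
  rw [h1, map_add]
  refine IsNilpotent.isUnit_add_left_of_commute ?_ ?_ (Commute.all _ _)
  · rw [map_add, map_mul]
    exact (Commute.all _ _).isNilpotent_add (hC _ (by simp))
      ((Commute.all _ _).isNilpotent_mul_right hYn)
  · exact ((isUnit_iff_ne_zero.2 hu).map Polynomial.C).map Polynomial.C |>.map _

section
variable {ρ : ℂ} {g : Fin 2 → MvPolynomial (Fin 2) ℂ} {P Q e : Polynomial (Polynomial ℂ)} {N n : ℕ}

/-- `Q` is a unit at `(ρ, 0)`, so modulo `z 1 ^ N` the polynomial `g 0` may be replaced by `P` in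
the local ring. Both variables are nilpotent modulo `(P, g 1, X ^ N)`, hence that quotient is
already local and needs no localization. -/
theorem exists_rank_truncated_quotient (hP : P.Monic)
    (hPX : ∀ i < P.natDegree, (P.coeff i).coeff 0 = 0) (hQ : (Q.coeff 0).coeff 0 ≠ 0)
    (h0 : shiftEquiv ρ (g 0) = P * Q + Polynomial.C (Polynomial.X ^ N) * e)
    (hn : (shiftEquiv ρ (g 1)).natDegree ≤ n) :
    ∃ s : ℕ, Module.rank ℂ (Localization.AtPrime (pointIdeal ![ρ, 0]) ⧸
        (Ideal.span (Set.range g) ⊔ Ideal.span {X 1 ^ N}).map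
          (algebraMap _ (Localization.AtPrime (pointIdeal ![ρ, 0])))) = s ∧
      Polynomial.X ^ s ∣ Polynomial.resultant P (shiftEquiv ρ (g 1)) P.natDegree n ∧
      (s < N → ¬ Polynomial.X ^ (s + 1) ∣
        Polynomial.resultant P (shiftEquiv ρ (g 1)) P.natDegree n) := by
  obtain ⟨s, Λ, hsurj, hker, hs, hs'⟩ :=
    Polynomial.exists_quotient_coordinates P (shiftEquiv ρ (g 1)) hP hn N
  let J' : Ideal (Polynomial (Polynomial ℂ)) :=
    Ideal.span {P, shiftEquiv ρ (g 1), Polynomial.C (Polynomial.X ^ N)}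
  have hJ' : ∀ x, x ∈ J' ↔ ∃ a b c,
      x = P * a + shiftEquiv ρ (g 1) * b + Polynomial.C (Polynomial.X ^ N) * c := by
    intro x
    simp only [J', Ideal.mem_span_insert, Ideal.mem_span_singleton']
    constructor
    · rintro ⟨a, _, ⟨b, _, ⟨c, rfl⟩, rfl⟩, rfl⟩
      exact ⟨a, b, c, by ring⟩
    · rintro ⟨a, b, c, rfl⟩
      exact ⟨a, _, ⟨b, _, ⟨c, rfl⟩, rfl⟩, by ring⟩
  let J : Ideal (MvPolynomial (Fin 2) ℂ) := J'.comap (shiftEquiv ρ)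
  have hJ : ∀ x, x ∈ J ↔ shiftEquiv ρ x ∈ J' := fun x => Iff.rfl
  refine ⟨s, ?_, hs, hs'⟩
  refine rank_localization_quotient_eq (pointIdeal ![ρ, 0]) _ J ?_ ?_ ?_
    (Λ ∘ₗ (shiftEquiv ρ).toLinearMap) ?_ ?_
  · refine sup_le (Ideal.span_le.2 ?_) (Ideal.span_le.2 ?_)
    · rintro _ ⟨i, rfl⟩
      refine (hJ _).2 ((hJ' _).2 ?_)
      fin_cases i
      · exact ⟨Q, 0, e, by simpa using h0⟩
      · exact ⟨0, 1, 0, by simp⟩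
    · rintro _ rfl
      exact (hJ _).2 ((hJ' _).2 ⟨0, 0, 1, by simp [shiftEquiv_X_one]⟩)
  · intro h hh
    obtain ⟨a, b, c, habc⟩ := (hJ' _).1 ((hJ _).1 hh)
    refine ⟨(shiftEquiv ρ).symm Q, ?_, ?_⟩
    · rwa [mem_pointIdeal_iff, AlgEquiv.apply_symm_apply]
    · have h1 : (shiftEquiv ρ).symm Q * h = g 0 * (shiftEquiv ρ).symm a +
          g 1 * (shiftEquiv ρ).symm (Q * b) + X 1 ^ N * (shiftEquiv ρ).symm (Q * c - e * a) := by
        apply (shiftEquiv ρ).injective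
        simp only [map_mul, map_add, map_pow, shiftEquiv_X_one, AlgEquiv.apply_symm_apply, habc, h0]
        ring
      rw [h1]
      refine Ideal.add_mem _ (Ideal.mem_sup_left (Ideal.add_mem _ ?_ ?_)) (Ideal.mem_sup_right ?_)
      · exact Ideal.mul_mem_right _ _ (Ideal.subset_span ⟨0, rfl⟩)
      · exact Ideal.mul_mem_right _ _ (Ideal.subset_span ⟨1, rfl⟩)
      · exact Ideal.mul_mem_right _ _ (Ideal.mem_span_singleton_self _)
  · intro u hu
    rw [mem_pointIdeal_iff] at hu
    have hPq : Ideal.Quotient.mk J' P = 0 :=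
      Ideal.Quotient.eq_zero_iff_mem.2 ((hJ' P).2 ⟨1, 0, 0, by ring⟩)
    have hXq : Ideal.Quotient.mk J' (Polynomial.C (Polynomial.X ^ N)) = 0 :=
      Ideal.Quotient.eq_zero_iff_mem.2
        ((hJ' (Polynomial.C (Polynomial.X ^ N))).2 ⟨0, 0, 1, by ring⟩)
    obtain ⟨v, hv⟩ := (Polynomial.isUnit_map_of_monic (K := ℂ)
      (T := Polynomial (Polynomial ℂ) ⧸ J') (Ideal.Quotient.mk J') (N := N) P hP hPX hPq hXq
      (shiftEquiv ρ u) hu).exists_right_inv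
    obtain ⟨v, rfl⟩ := Ideal.Quotient.mk_surjective v
    refine ⟨(shiftEquiv ρ).symm v, (hJ _).2 (Ideal.Quotient.eq_zero_iff_mem.1 ?_)⟩
    rw [map_sub, map_mul, AlgEquiv.apply_symm_apply, map_sub, map_mul, hv, map_one, map_one,
      sub_self]
  · rw [LinearMap.coe_comp]
    exact hsurj.comp (shiftEquiv ρ).surjective
  · intro x
    rw [LinearMap.comp_apply, hker, hJ, hJ']
    rfl

/-- Removes the truncation. The resultant is `X ^ s * h` with `h` a unit at the origin, and it lies
in `(P, g 1)`. Multiplying by `Q` and substituting `P * Q = g 0 - X ^ N * e` gives `X ^ s * (Q * h +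
X ^ (N - s) * e * a) ∈ (g 0, g 1)`. As `s < N`, the bracket is a unit at `(ρ, 0)`. -/
theorem map_sup_X_one_pow_eq (hd : P.natDegree ≠ 0) (hQ : (Q.coeff 0).coeff 0 ≠ 0)
    (h0 : shiftEquiv ρ (g 0) = P * Q + Polynomial.C (Polynomial.X ^ N) * e)
    (hn : (shiftEquiv ρ (g 1)).natDegree ≤ n) {s : ℕ} (hsN : s < N)
    (hs : Polynomial.X ^ s ∣ Polynomial.resultant P (shiftEquiv ρ (g 1)) P.natDegree n)
    (hs' : ¬ Polynomial.X ^ (s + 1) ∣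
      Polynomial.resultant P (shiftEquiv ρ (g 1)) P.natDegree n) :
    (Ideal.span (Set.range g) ⊔ Ideal.span {X 1 ^ N}).map
        (algebraMap _ (Localization.AtPrime (pointIdeal ![ρ, 0]))) =
      (Ideal.span (Set.range g)).map
        (algebraMap _ (Localization.AtPrime (pointIdeal ![ρ, 0]))) := by
  obtain ⟨h, hh⟩ := hs
  have hh0 : h.coeff 0 ≠ 0 := by
    intro h00
    obtain ⟨q, rfl⟩ := Polynomial.X_dvd_iff.2 h00
    exact hs' ⟨q, by rw [hh]; ring⟩
  obtain ⟨a, b, -, -, hab⟩ := Polynomial.exists_mul_add_mul_eq_C_resultant P (shiftEquiv ρ (g 1))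
    le_rfl hn (Or.inl hd)
  rw [hh] at hab
  rw [Ideal.map_sup, sup_eq_left, Ideal.map_span, Ideal.span_le, Set.image_singleton,
    Set.singleton_subset_iff, SetLike.mem_coe,
    IsLocalization.algebraMap_mem_map_algebraMap_iff (pointIdeal ![ρ, 0]).primeCompl]
  obtain ⟨k, rfl⟩ : ∃ k, N = s + (k + 1) := ⟨N - s - 1, by omega⟩
  refine ⟨(shiftEquiv ρ).symm (Q * Polynomial.C h + Polynomial.C (Polynomial.X ^ (k + 1)) * e * a),
    ?_, ?_⟩
  · change ¬ _ ∈ pointIdeal _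
    rw [mem_pointIdeal_iff, AlgEquiv.apply_symm_apply, mul_assoc]
    simp only [Polynomial.coeff_add, Polynomial.mul_coeff_zero, Polynomial.coeff_C_zero]
    simp [hh0, hQ]
  · have h1 : (shiftEquiv ρ).symm (Q * Polynomial.C h +
          Polynomial.C (Polynomial.X ^ (k + 1)) * e * a) * X 1 ^ (s + (k + 1)) =
        g 0 * (X 1 ^ (k + 1) * (shiftEquiv ρ).symm a) +
          g 1 * (X 1 ^ (k + 1) * (shiftEquiv ρ).symm (Q * b)) := by
      apply (shiftEquiv ρ).injective
      simp only [map_mul, map_add, map_pow, shiftEquiv_X_one, AlgEquiv.apply_symm_apply, h0] at hab ⊢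
      linear_combination (-Q) * Polynomial.C Polynomial.X ^ (k + 1) * hab
    rw [h1]
    exact Ideal.add_mem _ (Ideal.mul_mem_right _ _ (Ideal.subset_span ⟨0, rfl⟩))
      (Ideal.mul_mem_right _ _ (Ideal.subset_span ⟨1, rfl⟩))

end

/-! ### Multiplicity as the order of an analytic resultant. -/

/-- The polynomial with the given coefficients. -/
def Polynomial.ofCoeffs {R : Type*} [CommRing R] {k : ℕ} (q : Fin k → R) : Polynomial R :=
  ∑ j, Polynomial.C (q j) * Polynomial.X ^ (j : ℕ)

/-- The monic polynomial of degree `d` with the given lower coefficients. -/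
def Polynomial.monicOfCoeffs {R : Type*} [CommRing R] {d : ℕ} (p : Fin d → R) : Polynomial R :=
  Polynomial.X ^ d + Polynomial.ofCoeffs p

section
variable {R T : Type*} [CommRing R] [CommRing T] {d : ℕ} (p : Fin d → R)

theorem Polynomial.map_ofCoeffs (φ : R →+* T) :
    (Polynomial.ofCoeffs p).map φ = Polynomial.ofCoeffs fun i => φ (p i) := by
  simp [Polynomial.ofCoeffs, Polynomial.map_sum]

theorem Polynomial.map_monicOfCoeffs (φ : R →+* T) :
    (Polynomial.monicOfCoeffs p).map φ = Polynomial.monicOfCoeffs fun i => φ (p i) := by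
  simp [Polynomial.monicOfCoeffs, Polynomial.map_ofCoeffs]

theorem Polynomial.coeff_ofCoeffs (k : ℕ) :
    (Polynomial.ofCoeffs p).coeff k = if h : k < d then p ⟨k, h⟩ else 0 := by
  simp only [Polynomial.ofCoeffs, Polynomial.finsetSum_coeff, Polynomial.coeff_C_mul_X_pow]
  split_ifs with h
  · rw [Finset.sum_eq_single ⟨k, h⟩ (fun j _ hj => if_neg fun hk => hj (Fin.ext hk.symm)) (by simp)]
    simp
  · exact Finset.sum_eq_zero fun j _ => if_neg fun hk => h (by omega)

theorem Polynomial.ofCoeffs_mem_degreeLT : Polynomial.ofCoeffs p ∈ Polynomial.degreeLT R d := by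
  rw [Polynomial.mem_degreeLT, Polynomial.degree_lt_iff_coeff_zero]
  intro k hk
  rw [Polynomial.coeff_ofCoeffs, dif_neg (not_lt.2 hk)]

theorem Polynomial.monicOfCoeffs_monic : (Polynomial.monicOfCoeffs p).Monic :=
  Polynomial.monic_X_pow_add (Polynomial.mem_degreeLT.1 (Polynomial.ofCoeffs_mem_degreeLT p))

theorem Polynomial.natDegree_monicOfCoeffs [Nontrivial R] :
    (Polynomial.monicOfCoeffs p).natDegree = d := by
  have h := Polynomial.mem_degreeLT.1 (Polynomial.ofCoeffs_mem_degreeLT p)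
  apply Polynomial.natDegree_eq_of_degree_eq_some
  rw [Polynomial.monicOfCoeffs, Polynomial.degree_add_eq_left_of_degree_lt]
  · simp
  · simpa using h

theorem Polynomial.coeff_monicOfCoeffs (i : Fin d) :
    (Polynomial.monicOfCoeffs p).coeff i = p i := by
  rw [Polynomial.monicOfCoeffs, Polynomial.coeff_add, Polynomial.coeff_X_pow, if_neg i.2.ne,
    Polynomial.coeff_ofCoeffs, dif_pos i.2, zero_add]

end

theorem Polynomial.X_pow_dvd_iff_le_analyticOrderAt (r : Polynomial ℂ) (N : ℕ) :
    Polynomial.X ^ N ∣ r ↔ (N : ℕ∞) ≤ analyticOrderAt (fun t => r.eval t) 0 := by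
  have han : ∀ u : Polynomial ℂ, AnalyticAt ℂ (fun t => u.eval t) 0 := fun u =>
    u.differentiable.analyticAt 0
  constructor
  · rintro ⟨u, rfl⟩
    rw [natCast_le_analyticOrderAt (han _)]
    exact ⟨_, han u, by simp⟩
  · by_cases hr : r = 0
    · simp [hr]
    · obtain ⟨u, hu, hu0⟩ := Polynomial.exists_eq_pow_rootMultiplicity_mul_and_not_dvd r hr 0
      rw [map_zero, sub_zero] at hu hu0
      have h1 : analyticOrderAt (fun t => r.eval t) 0 = (r.rootMultiplicity 0 : ℕ) := by
        rw [(han _).analyticOrderAt_eq_natCast]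
        refine ⟨fun t => u.eval t, han u, ?_, ?_⟩
        · rwa [Polynomial.X_dvd_iff, Polynomial.coeff_zero_eq_eval_zero] at hu0
        · refine Eventually.of_forall fun t => ?_
          conv_lhs => rw [hu]
          simp
      rw [h1, Nat.cast_le]
      exact fun h => ((pow_dvd_pow _ h).mul_right u).trans (dvd_of_eq hu.symm)

/-- The functions of one complex variable that are analytic at the origin. -/
def analyticSubring : Subring (ℂ → ℂ) where
  carrier := {h : ℂ → ℂ | AnalyticAt ℂ h (0 : ℂ)}
  mul_mem' := fun {a b} (ha : AnalyticAt ℂ a 0) (hb : AnalyticAt ℂ b 0) => AnalyticAt.mul ha hb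
  one_mem' := (analyticAt_const : AnalyticAt ℂ (fun _ : ℂ => (1 : ℂ)) 0)
  add_mem' := fun {a b} (ha : AnalyticAt ℂ a 0) (hb : AnalyticAt ℂ b 0) => AnalyticAt.add ha hb
  zero_mem' := (analyticAt_const : AnalyticAt ℂ (fun _ : ℂ => (0 : ℂ)) 0)
  neg_mem' := fun {a} (ha : AnalyticAt ℂ a 0) => AnalyticAt.neg ha

/-- Evaluation of analytic functions. -/
def analyticEval (t : ℂ) : analyticSubring →+* ℂ :=
  (Pi.evalRingHom _ t).comp analyticSubring.subtype

/-- Polynomials as analytic functions. -/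
def polynomialToAnalytic : Polynomial ℂ →+* analyticSubring :=
  RingHom.codRestrict (RingHom.pi fun t => Polynomial.evalRingHom t) analyticSubring fun u =>
    u.differentiable.analyticAt 0

theorem analyticEval_polynomialToAnalytic (t : ℂ) (u : Polynomial ℂ) :
    analyticEval t (polynomialToAnalytic u) = u.eval t := rfl

theorem analyticEval_comp_polynomialToAnalytic (t : ℂ) :
    (analyticEval t).comp polynomialToAnalytic = Polynomial.evalRingHom t := rfl

/-- Taylor's formula. It replaces the analytic Weierstrass coefficients by polynomials, to which the
algebraic dimension count applies. -/
theorem exists_polynomial_congr (h : analyticSubring) (N : ℕ) :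
    ∃ (u : Polynomial ℂ) (F : analyticSubring),
      h = polynomialToAnalytic u + polynomialToAnalytic (Polynomial.X ^ N) * F := by
  obtain ⟨F, hF, hF'⟩ := h.2.exists_eq_sum_add_pow_mul N
  refine ⟨∑ i ∈ Finset.range N,
    Polynomial.C (iteratedDeriv i (h : ℂ → ℂ) 0 / i.factorial) * Polynomial.X ^ i, ⟨F, hF⟩, ?_⟩
  refine Subtype.ext (funext fun t => ?_)
  change (h : ℂ → ℂ) t = Polynomial.eval t _ + Polynomial.eval t _ * F t
  rw [hF' t]
  simp only [Polynomial.eval_finsetSum, Polynomial.eval_mul, Polynomial.eval_C,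
    Polynomial.eval_pow, Polynomial.eval_X, smul_eq_mul]
  congr 1
  exact Finset.sum_congr rfl fun i _ => by ring

theorem rank_quotient_anti {K S : Type*} [Field K] [CommRing S] [Algebra K S] (I J : Ideal S)
    (h : I ≤ J) : Module.rank K (S ⧸ J) ≤ Module.rank K (S ⧸ I) :=
  LinearMap.rank_le_of_surjective (Ideal.Quotient.factorₐ K h).toLinearMap
    (Ideal.Quotient.factor_surjective h)

section
variable {ρ : ℂ} {g : Fin 2 → MvPolynomial (Fin 2) ℂ} {d m n : ℕ}

/-- The multiplicity of a common zero is the order of vanishing of the resultant of the Weierstrass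
factor of the first polynomial and of the second one. -/
theorem multiplicityAt_eq_analyticOrderAt (p : ℂ → Fin d → ℂ) (q : ℂ → Fin m → ℂ)
    (hp : ∀ i, AnalyticAt ℂ (fun t => p t i) 0) (hq : ∀ i, AnalyticAt ℂ (fun t => q t i) 0)
    (hd : d ≠ 0) (hp0 : p 0 = 0) (hq0 : (Polynomial.ofCoeffs (q 0)).coeff 0 ≠ 0)
    (h0 : ∀ᶠ t in 𝓝 0, (shiftEquiv ρ (g 0)).map (Polynomial.evalRingHom t) =
      Polynomial.monicOfCoeffs (p t) * Polynomial.ofCoeffs (q t))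
    (hn : (shiftEquiv ρ (g 1)).natDegree ≤ n) :
    multiplicityAt g ![ρ, 0] = analyticOrderAt (fun t => Polynomial.resultant
      (Polynomial.monicOfCoeffs (p t)) ((shiftEquiv ρ (g 1)).map (Polynomial.evalRingHom t)) d n)
      0 := by
  set D : ℂ → ℂ := fun t => Polynomial.resultant
      (Polynomial.monicOfCoeffs (p t)) ((shiftEquiv ρ (g 1)).map (Polynomial.evalRingHom t)) d n
    with hD
  let pa : Fin d → analyticSubring := fun i => ⟨fun t => p t i, hp i⟩
  let qa : Fin m → analyticSubring := fun i => ⟨fun t => q t i, hq i⟩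
  let Da : analyticSubring := Polynomial.resultant (Polynomial.monicOfCoeffs pa)
    ((shiftEquiv ρ (g 1)).map polynomialToAnalytic) d n
  have hDa : (Da : ℂ → ℂ) = D := by
    funext t
    change analyticEval t Da = D t
    rw [← Polynomial.resultant_map_map, Polynomial.map_monicOfCoeffs, Polynomial.map_map,
      analyticEval_comp_polynomialToAnalytic]
    rfl
  -- With `z 1 ^ N` added to the ideal, the dimension `s` either is at least `N`, and then so is the
  -- order of `D`, or equals that order, and then the added power is redundant.
  have key : ∀ N : ℕ, 0 < N → ∃ s : ℕ, Module.rank ℂ (Localization.AtPrime (pointIdeal ![ρ, 0]) ⧸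
        (Ideal.span (Set.range g) ⊔ Ideal.span {X 1 ^ N}).map
          (algebraMap _ (Localization.AtPrime (pointIdeal ![ρ, 0])))) = s ∧
      (N ≤ s → (N : ℕ∞) ≤ analyticOrderAt D 0) ∧ (s < N → analyticOrderAt D 0 = s ∧
        (Ideal.span (Set.range g) ⊔ Ideal.span {X 1 ^ N}).map
          (algebraMap _ (Localization.AtPrime (pointIdeal ![ρ, 0]))) =
        (Ideal.span (Set.range g)).map
          (algebraMap _ (Localization.AtPrime (pointIdeal ![ρ, 0])))) := by
    intro N hN
    choose pN Fp hpN using fun i => exists_polynomial_congr (pa i) N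
    choose qN Fq hqN using fun i => exists_polynomial_congr (qa i) N
    let τ : analyticSubring := polynomialToAnalytic (Polynomial.X ^ N)
    let π := Ideal.Quotient.mk (Ideal.span {τ})
    have hπτ : π τ = 0 := Ideal.Quotient.eq_zero_iff_mem.2 (Ideal.mem_span_singleton_self _)
    have hπp : (Polynomial.monicOfCoeffs pa).map π =
        ((Polynomial.monicOfCoeffs pN).map polynomialToAnalytic).map π := by
      simp only [Polynomial.map_monicOfCoeffs]
      congr 1
      funext i
      rw [hpN, map_add, map_mul, hπτ, zero_mul, add_zero]
    have hπq : (Polynomial.ofCoeffs qa).map π =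
        ((Polynomial.ofCoeffs qN).map polynomialToAnalytic).map π := by
      simp only [Polynomial.map_ofCoeffs]
      congr 1
      funext i
      rw [hqN, map_add, map_mul, hπτ, zero_mul, add_zero]
    have hlift : ∀ x y : analyticSubring, π x = π y →
        (N : ℕ∞) ≤ analyticOrderAt ((x : ℂ → ℂ) - (y : ℂ → ℂ)) 0 := by
      intro x y hxy
      obtain ⟨F, hF⟩ := Ideal.mem_span_singleton.1 (Ideal.Quotient.eq.1 hxy)
      have : (x : ℂ → ℂ) - (y : ℂ → ℂ) = fun t => t ^ N * (F : ℂ → ℂ) t := by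
        have := congrArg Subtype.val hF
        funext t
        have := congrFun this t
        change _ = (Polynomial.X ^ N : Polynomial ℂ).eval t * (F : ℂ → ℂ) t at this
        simpa using this
      rw [this, natCast_le_analyticOrderAt (by exact (analyticAt_id.pow N).mul F.2)]
      exact ⟨F, F.2, by simp⟩
    have hzero : ∀ (h : analyticSubring) (u : Polynomial ℂ) (F : analyticSubring),
        h = polynomialToAnalytic u + polynomialToAnalytic (Polynomial.X ^ N) * F →
        u.eval 0 = (h : ℂ → ℂ) 0 := by
      intro h u F hF
      have := congrArg (analyticEval 0) hF
      simp only [map_add, map_mul, analyticEval_polynomialToAnalytic] at this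
      change (h : ℂ → ℂ) 0 = _ at this
      simpa [hN.ne'] using this.symm
    have hPQ : ∀ k, Polynomial.X ^ N ∣ (shiftEquiv ρ (g 0) -
        Polynomial.monicOfCoeffs pN * Polynomial.ofCoeffs qN).coeff k := by
      intro k
      have h1 : π ((Polynomial.monicOfCoeffs pa * Polynomial.ofCoeffs qa).coeff k) =
          π (polynomialToAnalytic
            ((Polynomial.monicOfCoeffs pN * Polynomial.ofCoeffs qN).coeff k)) := by
        rw [← Polynomial.coeff_map, ← Polynomial.coeff_map, ← Polynomial.coeff_map,
          Polynomial.map_mul, Polynomial.map_mul, Polynomial.map_mul, hπp, hπq]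
      rw [Polynomial.X_pow_dvd_iff_le_analyticOrderAt]
      refine (hlift _ _ h1).trans_eq (analyticOrderAt_congr ?_)
      filter_upwards [h0] with t ht
      have h2 : ((Polynomial.monicOfCoeffs pa * Polynomial.ofCoeffs qa).coeff k : ℂ → ℂ) t =
          ((shiftEquiv ρ (g 0)).coeff k).eval t := by
        change analyticEval t _ = Polynomial.evalRingHom t _
        rw [← Polynomial.coeff_map, ← Polynomial.coeff_map, ht, Polynomial.map_mul,
          Polynomial.map_monicOfCoeffs, Polynomial.map_ofCoeffs]
        rfl
      rw [Pi.sub_apply, h2, Polynomial.coeff_sub, Polynomial.eval_sub]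
      rfl
    choose e he using hPQ
    obtain ⟨E, hE⟩ : Polynomial.C (Polynomial.X ^ N) ∣ (shiftEquiv ρ (g 0) -
        Polynomial.monicOfCoeffs pN * Polynomial.ofCoeffs qN) :=
      Polynomial.C_dvd_iff_dvd_coeff _ _ |>.2 fun k => ⟨e k, he k⟩
    have hE' := sub_eq_iff_eq_add'.1 hE
    have hdeg : (Polynomial.monicOfCoeffs pN).natDegree = d :=
      Polynomial.natDegree_monicOfCoeffs pN
    have hQ : ((Polynomial.ofCoeffs qN).coeff 0).coeff 0 ≠ 0 := by
      rw [Polynomial.coeff_ofCoeffs] at hq0 ⊢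
      split_ifs at hq0 ⊢ with h
      · rw [Polynomial.coeff_zero_eq_eval_zero, hzero _ _ _ (hqN _)]
        exact hq0
      · exact absurd rfl hq0
    obtain ⟨s, hs, hs1, hs2⟩ := exists_rank_truncated_quotient (ρ := ρ) (g := g) (n := n)
      (Polynomial.monicOfCoeffs_monic pN) (fun i hi => by
        rw [hdeg] at hi
        rw [Polynomial.coeff_monicOfCoeffs pN ⟨i, hi⟩, Polynomial.coeff_zero_eq_eval_zero,
          hzero _ _ _ (hpN _)]
        exact congrFun hp0 _) hQ hE' hn
    -- The resultant is a polynomial in the coefficients, so it commutes with reduction modulo `t ^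
    -- N`.
    have h3 : (N : ℕ∞) ≤ analyticOrderAt (D - fun t => (Polynomial.resultant
        (Polynomial.monicOfCoeffs pN) (shiftEquiv ρ (g 1)) d n).eval t) 0 := by
      rw [← hDa]
      refine hlift Da (polynomialToAnalytic _) ?_
      rw [← Polynomial.resultant_map_map, ← Polynomial.resultant_map_map,
        ← Polynomial.resultant_map_map, hπp]
    refine ⟨s, hs, fun hsN => ?_, fun hsN => ⟨?_, ?_⟩⟩
    · rw [hdeg] at hs1
      rw [← sub_add_cancel D (fun t => (Polynomial.resultant
          (Polynomial.monicOfCoeffs pN) (shiftEquiv ρ (g 1)) d n).eval t)]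
      exact (le_min h3 ((Polynomial.X_pow_dvd_iff_le_analyticOrderAt _ _).1
        ((pow_dvd_pow _ hsN).trans hs1))).trans le_analyticOrderAt_add
    · have hs2 := hs2 hsN
      rw [hdeg, Polynomial.X_pow_dvd_iff_le_analyticOrderAt] at hs1 hs2
      have h4 : analyticOrderAt (fun t => (Polynomial.resultant
          (Polynomial.monicOfCoeffs pN) (shiftEquiv ρ (g 1)) d n).eval t) 0 = s := by
        refine le_antisymm ?_ hs1
        rw [not_le] at hs2
        push_cast at hs2
        exact Order.le_of_lt_add_one hs2
      rw [← h4, ← sub_add_cancel D (fun t => (Polynomial.resultant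
          (Polynomial.monicOfCoeffs pN) (shiftEquiv ρ (g 1)) d n).eval t)]
      apply analyticOrderAt_add_eq_right_of_lt
      rw [h4]
      exact lt_of_lt_of_le (by exact_mod_cast hsN) h3
    · exact map_sup_X_one_pow_eq (by rwa [hdeg]) hQ hE' hn hsN hs1 (hs2 hsN)
  have hle : ∀ N : ℕ, Module.rank ℂ (Localization.AtPrime (pointIdeal ![ρ, 0]) ⧸
        (Ideal.span (Set.range g) ⊔ Ideal.span {X 1 ^ N}).map
          (algebraMap _ (Localization.AtPrime (pointIdeal ![ρ, 0])))) ≤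
      Module.rank ℂ (Localization.AtPrime (pointIdeal ![ρ, 0]) ⧸
        (Ideal.span (Set.range g)).map
          (algebraMap _ (Localization.AtPrime (pointIdeal ![ρ, 0])))) := by
    intro N
    exact rank_quotient_anti _ _ (Ideal.map_mono le_sup_left)
  unfold multiplicityAt
  -- Infinite order makes the truncated dimensions unbounded; for finite order `k`, truncation at `k
  -- + 1` loses nothing.
  cases hk : analyticOrderAt D 0 with
  | top =>
    rw [Cardinal.toENat_eq_top, Cardinal.aleph0_le]
    intro N
    obtain ⟨s, hs, -, hs'⟩ := key (N + 1) N.succ_pos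
    have h5 : N + 1 ≤ s := by
      by_contra hlt
      have := (hs' (not_le.1 hlt)).1
      rw [hk] at this
      exact ENat.top_ne_natCast s this
    refine le_trans ?_ (hle (N + 1))
    rw [hs]
    exact_mod_cast (Nat.le_succ N).trans h5
  | coe k =>
    obtain ⟨s, hs, hs', hs''⟩ := key (k + 1) k.succ_pos
    have hlt : s < k + 1 := by
      by_contra hle'
      have := hs' (not_lt.1 hle')
      rw [hk] at this
      exact absurd (by exact_mod_cast this) (Nat.not_succ_le_self k)
    obtain ⟨h6, h7⟩ := hs'' hlt
    rw [hk] at h6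
    rw [← h7, hs, h6]
    simp

end

/-! ### Weierstrass factors from the inverse function theorem. -/

theorem Polynomial.ofCoeffs_coeff {R : Type*} [CommRing R] {k : ℕ} {f : Polynomial R}
    (hf : f ∈ Polynomial.degreeLT R k) :
    Polynomial.ofCoeffs (fun i : Fin k => f.coeff i) = f := by
  ext i
  rw [Polynomial.coeff_ofCoeffs]
  split_ifs with h
  · rfl
  · exact ((Polynomial.degree_lt_iff_coeff_zero _ _).1 (Polynomial.mem_degreeLT.1 hf) i
      (not_lt.1 h)).symm

theorem Polynomial.ofCoeffs_injective {R : Type*} [CommRing R] {k : ℕ} :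
    Function.Injective (Polynomial.ofCoeffs : (Fin k → R) → Polynomial R) := by
  intro p q h
  funext i
  have := congrArg (fun f => f.coeff i) h
  simpa [Polynomial.coeff_ofCoeffs] using this

theorem Polynomial.ofCoeffs_add {R : Type*} [CommRing R] {k : ℕ} (p q : Fin k → R) :
    Polynomial.ofCoeffs (p + q) = Polynomial.ofCoeffs p + Polynomial.ofCoeffs q := by
  ext i
  simp only [Polynomial.coeff_add, Polynomial.coeff_ofCoeffs]
  split_ifs <;> simp

theorem Polynomial.ofCoeffs_smul {R : Type*} [CommRing R] {k : ℕ} (t : R) (p : Fin k → R) :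
    Polynomial.ofCoeffs (t • p) = t • Polynomial.ofCoeffs p := by
  ext i
  simp only [Polynomial.coeff_smul, Polynomial.coeff_ofCoeffs]
  split_ifs <;> simp

theorem Polynomial.monicOfCoeffs_mul_mem_degreeLT {R : Type*} [CommRing R] [Nontrivial R] {d k : ℕ}
    (p : Fin d → R) (q : Fin k → R) :
    Polynomial.monicOfCoeffs p * Polynomial.ofCoeffs q ∈ Polynomial.degreeLT R (d + k) := by
  have hq := Polynomial.mem_degreeLT.1 (Polynomial.ofCoeffs_mem_degreeLT q)
  rw [Polynomial.mem_degreeLT, (Polynomial.monicOfCoeffs_monic p).degree_mul_comm,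
    (Polynomial.monicOfCoeffs_monic p).degree_mul,
    Polynomial.degree_eq_natDegree (Polynomial.monicOfCoeffs_monic p).ne_zero,
    Polynomial.natDegree_monicOfCoeffs, Nat.cast_add, add_comm (d : WithBot ℕ)]
  exact WithBot.add_lt_add_right (WithBot.coe_ne_bot) hq

/-- The coefficients of a product of a monic polynomial with another polynomial. -/
def mulCoeffs (d k : ℕ) (x : (Fin d → ℂ) × (Fin k → ℂ)) : Fin (d + k) → ℂ :=
  fun i => (Polynomial.monicOfCoeffs x.1 * Polynomial.ofCoeffs x.2).coeff i

theorem ofCoeffs_mulCoeffs {d k : ℕ} (x : (Fin d → ℂ) × (Fin k → ℂ)) :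
    Polynomial.ofCoeffs (mulCoeffs d k x) =
      Polynomial.monicOfCoeffs x.1 * Polynomial.ofCoeffs x.2 :=
  Polynomial.ofCoeffs_coeff (Polynomial.monicOfCoeffs_mul_mem_degreeLT _ _)

theorem contDiff_mulCoeffs (d k : ℕ) : ContDiff ℂ ω (mulCoeffs d k) := by
  have hp : ∀ a, ContDiff ℂ ω fun x : (Fin d → ℂ) × (Fin k → ℂ) =>
      (Polynomial.monicOfCoeffs x.1).coeff a := by
    intro a
    simp only [Polynomial.monicOfCoeffs, Polynomial.coeff_add, Polynomial.coeff_ofCoeffs]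
    split_ifs <;> fun_prop
  have hq : ∀ b, ContDiff ℂ ω fun x : (Fin d → ℂ) × (Fin k → ℂ) =>
      (Polynomial.ofCoeffs x.2).coeff b := by
    intro b
    simp only [Polynomial.coeff_ofCoeffs]
    split_ifs <;> fun_prop
  rw [contDiff_pi]
  intro i
  simp only [mulCoeffs, Polynomial.coeff_mul]
  exact ContDiff.sum fun ab _ => (hp _).mul (hq _)

/-- At `(0, u)` the monic factor is `X ^ d`. Along a line the product is quadratic in the parameter,
and the derivative is its linear coefficient. -/
theorem fderiv_mulCoeffs {d k : ℕ} (u : Fin k → ℂ) (v : (Fin d → ℂ) × (Fin k → ℂ)) :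
    Polynomial.ofCoeffs (fderiv ℂ (mulCoeffs d k) (0, u) v) =
      Polynomial.X ^ d * Polynomial.ofCoeffs v.2 +
        Polynomial.ofCoeffs v.1 * Polynomial.ofCoeffs u := by
  have hd := ((contDiff_mulCoeffs d k).differentiable (by simp) (0, u)).hasFDerivAt
  have hl := hd.hasLineDerivAt v
  have hmem : Polynomial.X ^ d * Polynomial.ofCoeffs v.2 +
      Polynomial.ofCoeffs v.1 * Polynomial.ofCoeffs u ∈ Polynomial.degreeLT ℂ (d + k) := by
    have h1 := Polynomial.monicOfCoeffs_mul_mem_degreeLT v.1 u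
    have h2 := Polynomial.monicOfCoeffs_mul_mem_degreeLT (0 : Fin d → ℂ) v.2
    have h3 := Polynomial.monicOfCoeffs_mul_mem_degreeLT (0 : Fin d → ℂ) u
    have h0 : Polynomial.ofCoeffs (0 : Fin d → ℂ) = 0 := by simp [Polynomial.ofCoeffs]
    convert! Submodule.add_mem _ (Submodule.sub_mem _ h1 h3) h2 using 1
    simp only [Polynomial.monicOfCoeffs, h0]
    ring
  rw [← Polynomial.ofCoeffs_coeff hmem]
  congr 1
  funext i
  have hl2 := (hasDerivAt_pi.1 hl i)
  refine hl2.unique ?_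
  have h4 : ∀ t : ℂ, mulCoeffs d k ((0, u) + t • v) i =
      (Polynomial.X ^ d * Polynomial.ofCoeffs u).coeff i +
      t * (Polynomial.X ^ d * Polynomial.ofCoeffs v.2 +
        Polynomial.ofCoeffs v.1 * Polynomial.ofCoeffs u).coeff i +
      t ^ 2 * (Polynomial.ofCoeffs v.1 * Polynomial.ofCoeffs v.2).coeff i := by
    intro t
    rw [← Polynomial.coeff_C_mul, ← Polynomial.coeff_C_mul, ← Polynomial.coeff_add,
      ← Polynomial.coeff_add]
    simp only [mulCoeffs, Polynomial.monicOfCoeffs, Prod.fst_add, Prod.snd_add, Prod.smul_fst,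
      Prod.smul_snd, zero_add, Polynomial.ofCoeffs_add, Polynomial.ofCoeffs_smul,
      Polynomial.smul_eq_C_mul, map_pow]
    congr 1
    ring
  simp only [h4]
  have := (((hasDerivAt_id (0 : ℂ)).mul_const ((Polynomial.X ^ d * Polynomial.ofCoeffs v.2 +
        Polynomial.ofCoeffs v.1 * Polynomial.ofCoeffs u).coeff i)).const_add
        ((Polynomial.X ^ d * Polynomial.ofCoeffs u).coeff i)).add
        (((hasDerivAt_id (0 : ℂ)).pow 2).mul_const
          ((Polynomial.ofCoeffs v.1 * Polynomial.ofCoeffs v.2).coeff i))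
  convert! this using 1
  simp

/-- Analytic factorization of the polynomials near `X ^ d * u`, where `u` does not vanish at the
origin, into a monic factor of degree `d` and a cofactor. -/
theorem exists_analytic_factorization (d : ℕ) {k : ℕ} (u : Fin k → ℂ)
    (hu : (Polynomial.ofCoeffs u).coeff 0 ≠ 0) :
    ∃ (p : (Fin (d + k) → ℂ) → Fin d → ℂ) (q : (Fin (d + k) → ℂ) → Fin k → ℂ),
      AnalyticAt ℂ p (mulCoeffs d k (0, u)) ∧ AnalyticAt ℂ q (mulCoeffs d k (0, u)) ∧
      p (mulCoeffs d k (0, u)) = 0 ∧ q (mulCoeffs d k (0, u)) = u ∧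
      ∀ᶠ v in 𝓝 (mulCoeffs d k (0, u)),
        Polynomial.monicOfCoeffs (p v) * Polynomial.ofCoeffs (q v) = Polynomial.ofCoeffs v := by
  -- Since `u` does not vanish at `0`, it is coprime to `X ^ d`. A kernel element then has `X ^ d ∣
  -- v.1`, which the degree bound turns into `v.1 = 0`, and hence `v.2 = 0`.
  have hinj : Function.Injective (fderiv ℂ (mulCoeffs d k) (0, u) :
      (Fin d → ℂ) × (Fin k → ℂ) →ₗ[ℂ] (Fin (d + k) → ℂ)) := by
    rw [injective_iff_map_eq_zero]
    intro v hv
    have h1 := fderiv_mulCoeffs u v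
    have h0 : ∀ j, Polynomial.ofCoeffs (0 : Fin j → ℂ) = 0 := by simp [Polynomial.ofCoeffs]
    rw [ContinuousLinearMap.coe_coe] at hv
    rw [hv, h0] at h1
    have hcop : IsCoprime ((Polynomial.X : Polynomial ℂ) ^ d) (Polynomial.ofCoeffs u) := by
      refine IsCoprime.pow_left ?_
      rw [Polynomial.prime_X.irreducible.coprime_iff_not_dvd, Polynomial.X_dvd_iff]
      exact hu
    have h2 : (Polynomial.X : Polynomial ℂ) ^ d ∣ Polynomial.ofCoeffs v.1 := by
      refine hcop.dvd_of_dvd_mul_right ⟨-Polynomial.ofCoeffs v.2, ?_⟩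
      linear_combination -h1
    have h3 : Polynomial.ofCoeffs v.1 = 0 := by
      refine Polynomial.eq_zero_of_dvd_of_degree_lt h2 ?_
      rw [Polynomial.degree_X_pow]
      exact Polynomial.mem_degreeLT.1 (Polynomial.ofCoeffs_mem_degreeLT _)
    rw [h3, zero_mul, add_zero, zero_eq_mul] at h1
    have h4 := h1.resolve_left (pow_ne_zero _ Polynomial.X_ne_zero)
    exact Prod.ext (Polynomial.ofCoeffs_injective (h3.trans (h0 _).symm))
      (Polynomial.ofCoeffs_injective (h4.trans (h0 _).symm))
  let e := (LinearEquiv.ofInjectiveOfFinrankEq _ hinj (by simp)).toContinuousLinearEquiv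
  have he : (e : (Fin d → ℂ) × (Fin k → ℂ) →L[ℂ] (Fin (d + k) → ℂ)) =
      fderiv ℂ (mulCoeffs d k) (0, u) := by
    ext <;> rfl
  have hcd : ContDiffAt ℂ ω (mulCoeffs d k) (0, u) := (contDiff_mulCoeffs d k).contDiffAt
  have hf : HasFDerivAt (mulCoeffs d k)
      (e : (Fin d → ℂ) × (Fin k → ℂ) →L[ℂ] (Fin (d + k) → ℂ)) (0, u) := by
    rw [he]
    exact ((contDiff_mulCoeffs d k).differentiable (by simp) (0, u)).hasFDerivAt
  have hinv := (hcd.to_localInverse hf (by simp)).analyticAt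
  have himg := hcd.localInverse_apply_image hf (by simp)
  have hright := (hcd.hasStrictFDerivAt' hf (by simp)).eventually_right_inverse
  refine ⟨fun v => (hcd.localInverse hf (by simp) v).1,
    fun v => (hcd.localInverse hf (by simp) v).2,
    analyticAt_fst.comp hinv, analyticAt_snd.comp hinv, ?_, ?_, ?_⟩
  · simp only [himg]
  · simp only [himg]
  · filter_upwards [hright] with v hv
    rw [← ofCoeffs_mulCoeffs]
    exact congrArg _ hv

/-! ### Leading coefficients and order jumps of analytic families. -/

/-- Each division by `t` is a `dslope`, bounded by the Schwarz lemma at the cost of a factor `3 /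
r`. The final constant depends only on `r`, `B` and `c`, which makes the estimate uniform over a
family. -/
theorem exists_eq_pow_mul_of_le_analyticOrderAt {r : ℝ} (hr : 0 < r) (c : ℕ) :
    ∀ {B : ℝ} {h : ℂ → ℂ}, DifferentiableOn ℂ h (Metric.ball 0 r) → 0 < B →
      (∀ t ∈ Metric.ball (0 : ℂ) r, ‖h t‖ ≤ B) → (c : ℕ∞) ≤ analyticOrderAt h 0 →
      ∃ F : ℂ → ℂ, DifferentiableOn ℂ F (Metric.ball 0 r) ∧
        (∀ t ∈ Metric.ball (0 : ℂ) r, h t = t ^ c * F t) ∧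
        ∀ t ∈ Metric.ball (0 : ℂ) r, ‖F t - F 0‖ ≤ (3 / r) ^ (c + 1) * B * ‖t‖ := by
  have hball : Metric.ball (0 : ℂ) r ∈ 𝓝 (0 : ℂ) := Metric.ball_mem_nhds _ hr
  have hds : ∀ {B : ℝ} {h : ℂ → ℂ}, DifferentiableOn ℂ h (Metric.ball 0 r) → 0 < B →
      (∀ t ∈ Metric.ball (0 : ℂ) r, ‖h t‖ ≤ B) →
      ∀ t ∈ Metric.ball (0 : ℂ) r, ‖dslope h 0 t‖ ≤ 3 / r * B := by
    intro B h hh hB hb t ht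
    -- The difference is at most `2 * B`; the radius `3 * B` gives the strict inequality of an open
    -- ball.
    have hmaps : Set.MapsTo h (Metric.ball 0 r) (Metric.ball (h 0) (3 * B)) := by
      intro s hs
      rw [mem_ball_iff_norm]
      have h1 := norm_sub_le (h s) (h 0)
      have h2 := hb s hs
      have h3 := hb 0 (Metric.mem_ball_self hr)
      linarith
    have := Complex.norm_dslope_le_div_of_mapsTo_ball hh
      (hmaps.mono_right Metric.ball_subset_closedBall) ht
    rwa [mul_div_right_comm] at this
  induction c with
  | zero =>
    intro B h hh hB hb _
    refine ⟨h, hh, fun t _ => by simp, fun t ht => ?_⟩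
    have h1 : h t - h 0 = t * dslope h 0 t := by
      have := sub_smul_dslope h 0 t
      rw [sub_zero, smul_eq_mul] at this
      exact this.symm
    rw [h1, norm_mul, mul_comm]
    simpa using mul_le_mul_of_nonneg_right (hds hh hB hb t ht) (norm_nonneg t)
  | succ c ih =>
    intro B h hh hB hb hord
    have h0 : h 0 = 0 := by
      apply apply_eq_zero_of_analyticOrderAt_ne_zero
      intro h1
      rw [h1] at hord
      exact absurd hord (by simp)
    have heq : ∀ t, h t = t * dslope h 0 t := by
      intro t
      have := sub_smul_dslope h 0 t
      rw [sub_zero, smul_eq_mul, h0, sub_zero] at this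
      exact this.symm
    have hd : DifferentiableOn ℂ (dslope h 0) (Metric.ball 0 r) :=
      (Complex.differentiableOn_dslope hball).2 hh
    have hdan : AnalyticAt ℂ (dslope h 0) 0 := hd.analyticAt hball
    have hord' : (c : ℕ∞) ≤ analyticOrderAt (dslope h 0) 0 := by
      have h2 : analyticOrderAt h 0 = 1 + analyticOrderAt (dslope h 0) 0 := by
        have h3 : h = (id : ℂ → ℂ) * dslope h 0 := funext heq
        conv_lhs => rw [h3]
        rw [analyticOrderAt_mul analyticAt_id hdan, analyticOrderAt_id]
      rw [h2, Nat.cast_add, Nat.cast_one, add_comm] at hord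
      exact (ENat.add_le_add_iff_left (by simp)).1 hord
    obtain ⟨F, hF, hF', hF''⟩ := ih hd (by positivity) (hds hh hB hb) hord'
    refine ⟨F, hF, fun t ht => ?_, fun t ht => ?_⟩
    · rw [heq, hF' t ht]
      ring
    · refine (hF'' t ht).trans_eq ?_
      ring

section
variable {E : Type*} [NormedAddCommGroup E] [NormedSpace ℂ E] {D : E → ℂ → ℂ}

theorem AnalyticAt.exists_ball_bound {y₀ : E} [CompleteSpace E]
    (hD : AnalyticAt ℂ (fun x : E × ℂ => D x.1 x.2) (y₀, 0)) :
    ∃ r > 0, ∃ B > 0, ∀ y ∈ Metric.ball y₀ r, ∀ t ∈ Metric.ball (0 : ℂ) r,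
      ‖D y t‖ ≤ B ∧ AnalyticAt ℂ (fun x : E × ℂ => D x.1 x.2) (y, t) := by
  have h1 : ∀ᶠ x in 𝓝 ((y₀, 0) : E × ℂ), ‖D x.1 x.2‖ < ‖D y₀ 0‖ + 1 :=
    hD.continuousAt.norm.eventually (gt_mem_nhds (lt_add_one _))
  obtain ⟨r, hr, hball⟩ := Metric.eventually_nhds_iff_ball.1 (h1.and hD.eventually_analyticAt)
  refine ⟨r, hr, ‖D y₀ 0‖ + 1, by positivity, fun y hy t ht => ?_⟩
  have h2 := hball (y, t) (by rw [← ball_prod_same]; exact ⟨hy, ht⟩)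
  exact ⟨h2.1.le, h2.2⟩

/-- The leading coefficient in `t` of an analytic function `D y t` that vanishes at `t = 0` at
least to order `c`. -/
theorem exists_leadingCoeff [CompleteSpace E]
    (hD : ∀ y, AnalyticAt ℂ (fun x : E × ℂ => D x.1 x.2) (y, 0)) (c : ℕ)
    (hc : ∀ y, (c : ℕ∞) ≤ analyticOrderAt (D y) 0) :
    ∃ a : E → ℂ, (∀ y, a y = 0 ↔ (c : ℕ∞) < analyticOrderAt (D y) 0) ∧
      (∀ y₀, ∃ r > 0, ∃ C, 0 ≤ C ∧ ∀ y ∈ Metric.ball y₀ r, ∀ t ∈ Metric.ball (0 : ℂ) r,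
        AnalyticAt ℂ (fun x : E × ℂ => D x.1 x.2) (y, t) ∧
        ‖D y t - a y * t ^ c‖ ≤ C * ‖t‖ ^ (c + 1)) := by
  have hDy : ∀ y t, AnalyticAt ℂ (fun x : E × ℂ => D x.1 x.2) (y, t) → AnalyticAt ℂ (D y) t :=
    fun y t h => AnalyticAt.comp (f := fun t : ℂ => (y, t)) h (by fun_prop)
  choose F hFan hF using fun y =>
    (natCast_le_analyticOrderAt (hDy y 0 (hD y))).1 (hc y)
  refine ⟨fun y => F y 0, fun y => ?_, fun y₀ => ?_⟩
  · have h1 : analyticOrderAt (D y) 0 = c + analyticOrderAt (F y) 0 := by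
      have h2 : D y =ᶠ[𝓝 0] (id : ℂ → ℂ) ^ c * F y := by
        filter_upwards [hF y] with t ht
        simpa using ht
      rw [analyticOrderAt_congr h2, analyticOrderAt_mul (analyticAt_id.pow c) (hFan y),
        analyticOrderAt_pow analyticAt_id, analyticOrderAt_id]
      simp
    rw [h1, ← (hFan y).analyticOrderAt_ne_zero]
    constructor
    · intro h
      simpa using (ENat.add_lt_add_iff_left (ENat.natCast_ne_top c)).2 (pos_iff_ne_zero.2 h)
    · rintro h h0
      rw [h0, add_zero] at h
      exact lt_irrefl _ h
  · obtain ⟨r, hr, B, hB, hball⟩ := (hD y₀).exists_ball_bound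
    refine ⟨r, hr, (3 / r) ^ (c + 1) * B, by positivity, fun y hy t ht => ⟨(hball y hy t ht).2, ?_⟩⟩
    obtain ⟨F', hF'd, hF'eq, hF'b⟩ := exists_eq_pow_mul_of_le_analyticOrderAt hr c
      (fun t ht => (hDy y t (hball y hy t ht).2).differentiableAt.differentiableWithinAt) hB
      (fun t ht => (hball y hy t ht).1) (hc y)
    -- `F y` comes from the germ at `0` and defines `a`; `F'` carries the uniform bound. Both are `D
    -- y t / t ^ c` off `0`, hence agree at `0` by continuity.
    have hF0 : F y 0 = F' 0 := by
      have h3 : ∀ᶠ t in 𝓝[≠] (0 : ℂ), F y t = F' t := by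
        filter_upwards [(hF y).filter_mono nhdsWithin_le_nhds, self_mem_nhdsWithin,
          nhdsWithin_le_nhds (Metric.ball_mem_nhds (0 : ℂ) hr)] with t h1 h2 h3
        rw [hF'eq t h3, sub_zero, smul_eq_mul] at h1
        exact (mul_left_cancel₀ (pow_ne_zero _ h2) h1).symm
      have h4 := ((hFan y).continuousAt.tendsto.mono_left nhdsWithin_le_nhds).congr' h3
      exact tendsto_nhds_unique h4
        ((hF'd.continuousOn.continuousAt (Metric.ball_mem_nhds _ hr)).tendsto.mono_left
          nhdsWithin_le_nhds)
    change ‖D y t - F y 0 * t ^ c‖ ≤ _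
    rw [hF'eq t ht, hF0]
    have h5 : t ^ c * F' t - F' 0 * t ^ c = t ^ c * (F' t - F' 0) := by ring
    rw [h5, norm_mul, norm_pow, pow_succ]
    calc ‖t‖ ^ c * ‖F' t - F' 0‖ ≤ ‖t‖ ^ c * ((3 / r) ^ (c + 1) * B * ‖t‖) :=
          mul_le_mul_of_nonneg_left (hF'b t ht) (by positivity)
      _ = _ := by ring

section
variable {c : ℕ} {a : E → ℂ}

/-- After division by `t ^ c` the error is `C * ‖t‖`, uniformly in `y`. Through this limit `a`
inherits continuity, and holomorphy on complex lines, from the slices of `D` at fixed `t`. -/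
theorem tendstoUniformlyOn_div_pow {E : Type*} [NormedAddCommGroup E] {D : E → ℂ → ℂ} {c : ℕ}
    {a : E → ℂ} {y₀ : E} {r C : ℝ} (hr : 0 < r)
    (ha : ∀ y ∈ Metric.ball y₀ r, ∀ t ∈ Metric.ball (0 : ℂ) r,
      ‖D y t - a y * t ^ c‖ ≤ C * ‖t‖ ^ (c + 1)) :
    TendstoUniformlyOn (fun t y => D y t / t ^ c) a (𝓝[≠] (0 : ℂ)) (Metric.ball y₀ r) := by
  rw [Metric.tendstoUniformlyOn_iff]
  intro ε hε
  have h1 : Tendsto (fun t : ℂ => C * ‖t‖) (𝓝 0) (𝓝 0) := by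
    have : Continuous fun t : ℂ => C * ‖t‖ := by fun_prop
    simpa using this.tendsto 0
  filter_upwards [nhdsWithin_le_nhds (h1.eventually (gt_mem_nhds hε)), self_mem_nhdsWithin,
    nhdsWithin_le_nhds (Metric.ball_mem_nhds (0 : ℂ) hr)] with t ht1 ht0 htr y hy
  have ht0 : t ≠ 0 := ht0
  have h2 : D y t / t ^ c - a y = (D y t - a y * t ^ c) / t ^ c := by
    field_simp
  rw [dist_comm, dist_eq_norm, h2, norm_div, norm_pow]
  refine lt_of_le_of_lt ?_ ht1
  rw [div_le_iff₀ (by positivity)]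
  refine (ha y hy t htr).trans_eq (by ring)

theorem continuous_leadingCoeff
    (ha : ∀ y₀, ∃ r > 0, ∃ C, 0 ≤ C ∧ ∀ y ∈ Metric.ball y₀ r, ∀ t ∈ Metric.ball (0 : ℂ) r,
        AnalyticAt ℂ (fun x : E × ℂ => D x.1 x.2) (y, t) ∧
        ‖D y t - a y * t ^ c‖ ≤ C * ‖t‖ ^ (c + 1)) : Continuous a := by
  rw [continuous_iff_continuousAt]
  intro y₀
  obtain ⟨r, hr, C, -, h⟩ := ha y₀
  have h1 := tendstoUniformlyOn_div_pow hr fun y hy t ht => (h y hy t ht).2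
  refine (h1.continuousOn (Eventually.frequently ?_)).continuousAt (Metric.ball_mem_nhds _ hr)
  filter_upwards [nhdsWithin_le_nhds (Metric.ball_mem_nhds (0 : ℂ) hr)] with t ht y hy
  have h2 : ContinuousAt (fun y => D y t) y :=
    ContinuousAt.comp (f := fun y : E => (y, t)) (h y hy t ht).1.continuousAt (by fun_prop)
  exact (h2.div_const _).continuousWithinAt

theorem differentiable_leadingCoeff_line
    (ha : ∀ y₀, ∃ r > 0, ∃ C, 0 ≤ C ∧ ∀ y ∈ Metric.ball y₀ r, ∀ t ∈ Metric.ball (0 : ℂ) r,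
        AnalyticAt ℂ (fun x : E × ℂ => D x.1 x.2) (y, t) ∧
        ‖D y t - a y * t ^ c‖ ≤ C * ‖t‖ ^ (c + 1)) (y v : E) :
    Differentiable ℂ fun l : ℂ => a (y + l • v) := by
  intro l₀
  obtain ⟨r, hr, C, -, h⟩ := ha (y + l₀ • v)
  have h1 := (tendstoUniformlyOn_div_pow hr fun y hy t ht => (h y hy t ht).2).comp
    fun l : ℂ => y + l • v
  have hcont : Continuous fun l : ℂ => y + l • v := by fun_prop
  have hopen := Metric.isOpen_ball (x := y + l₀ • v) (ε := r) |>.preimage hcont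
  refine (h1.tendstoLocallyUniformlyOn.differentiableOn ?_ hopen).differentiableAt
    (hopen.mem_nhds (Metric.mem_ball_self hr))
  filter_upwards [nhdsWithin_le_nhds (Metric.ball_mem_nhds (0 : ℂ) hr)] with t ht l hl
  have h2 : DifferentiableAt ℂ (fun l : ℂ => D (y + l • v) t) l :=
    DifferentiableAt.comp (f := fun l : ℂ => (y + l • v, t)) l
      (h _ hl t ht).1.differentiableAt (by fun_prop)
  exact (h2.div_const _).differentiableWithinAt

/-- A holomorphic function larger on the boundary of a disc than at its centre has a zero. -/
theorem exists_zero_of_norm_lt {f : ℂ → ℂ} {r ε : ℝ} (hr : 0 < r)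
    (hf : DifferentiableOn ℂ f (Metric.closedBall 0 r))
    (hs : ∀ l ∈ Metric.sphere (0 : ℂ) r, ε ≤ ‖f l‖) (h0 : ‖f 0‖ < ε) :
    ∃ l ∈ Metric.closedBall (0 : ℂ) r, f l = 0 := by
  by_contra! hne
  have hd : DiffContOnCl ℂ (fun l => (f l)⁻¹) (Metric.ball 0 r) := by
    apply DifferentiableOn.diffContOnCl
    rw [closure_ball _ hr.ne']
    exact hf.inv hne
  have hε : 0 < ε := (norm_nonneg _).trans_lt h0
  have h1 := Complex.norm_le_of_forall_mem_frontier_norm_le Metric.isBounded_ball hd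
    (C := ε⁻¹) (fun l hl => by
      rw [frontier_ball _ hr.ne'] at hl
      rw [norm_inv]
      exact inv_anti₀ hε (hs l hl)) (subset_closure (Metric.mem_ball_self hr))
  rw [norm_inv] at h1
  have h2 : 0 < ‖f 0‖ := norm_pos_iff.2 (hne 0 (Metric.mem_closedBall_self hr.le))
  exact absurd h0 (not_lt.2 ((inv_le_inv₀ h2 hε).1 h1))

end

/-- The set where the order of vanishing at `t = 0` of an analytic function `D y t` jumps. -/
def orderJump (D : E → ℂ → ℂ) : Set E :=
  {y | ∃ q, analyticOrderAt (D q) 0 < analyticOrderAt (D y) 0}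

theorem exists_leadingCoeff_orderJump [CompleteSpace E]
    (hD : ∀ y, AnalyticAt ℂ (fun x : E × ℂ => D x.1 x.2) (y, 0))
    (hne : ∃ y, analyticOrderAt (D y) 0 ≠ ⊤) :
    ∃ (c : ℕ) (a : E → ℂ), (∃ q, a q ≠ 0) ∧ orderJump D = {y | a y = 0} ∧
      (∀ y₀, ∃ r > 0, ∃ C, 0 ≤ C ∧ ∀ y ∈ Metric.ball y₀ r, ∀ t ∈ Metric.ball (0 : ℂ) r,
        AnalyticAt ℂ (fun x : E × ℂ => D x.1 x.2) (y, t) ∧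
        ‖D y t - a y * t ^ c‖ ≤ C * ‖t‖ ^ (c + 1)) := by
  obtain ⟨q, hq⟩ : ∃ q, ∀ y, analyticOrderAt (D q) 0 ≤ analyticOrderAt (D y) 0 := by
    obtain ⟨_, ⟨m, rfl⟩, h⟩ := (wellFounded_lt (α := ℕ∞)).has_min
      (Set.range fun y => analyticOrderAt (D y) 0) ⟨_, hne.choose, rfl⟩
    exact ⟨m, fun q => not_lt.mp (h _ ⟨q, rfl⟩)⟩
  obtain ⟨y₁, hy₁⟩ := hne
  obtain ⟨c, hc⟩ := ENat.ne_top_iff_exists.1 (ne_top_of_le_ne_top hy₁ (hq y₁))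
  rw [← hc] at hq
  obtain ⟨a, ha, hest⟩ := exists_leadingCoeff hD c hq
  refine ⟨c, a, ⟨q, fun h => ?_⟩, ?_, hest⟩
  · exact absurd ((ha q).1 h) (by rw [hc]; exact lt_irrefl _)
  · ext y
    rw [Set.mem_ofPred_eq, ha]
    exact ⟨fun ⟨q', h⟩ => (hq q').trans_lt h, fun h => ⟨q, hc ▸ h⟩⟩

theorem isClosed_orderJump [CompleteSpace E]
    (hD : ∀ y, AnalyticAt ℂ (fun x : E × ℂ => D x.1 x.2) (y, 0))
    (hne : ∃ y, analyticOrderAt (D y) 0 ≠ ⊤) : IsClosed (orderJump D) := by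
  obtain ⟨c, a, -, hZ, hest⟩ := exists_leadingCoeff_orderJump hD hne
  rw [hZ]
  exact isClosed_eq (continuous_leadingCoeff hest) continuous_const

/-- At a zero of `D` the estimate reads `‖a (q k)‖ * ‖t k‖ ^ c ≤ C * ‖t k‖ ^ (c + 1)`; since `t k ≠
0`, division gives `a (q k) → 0`. -/
theorem mem_orderJump_of_tendsto [CompleteSpace E]
    (hD : ∀ y, AnalyticAt ℂ (fun x : E × ℂ => D x.1 x.2) (y, 0))
    (hne : ∃ y, analyticOrderAt (D y) 0 ≠ ⊤) {y : E} {q : ℕ → E} {t : ℕ → ℂ}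
    (hq : Tendsto q atTop (𝓝 y)) (ht : Tendsto t atTop (𝓝 0)) (ht0 : ∀ k, t k ≠ 0)
    (hz : ∀ᶠ k in atTop, D (q k) (t k) = 0) : y ∈ orderJump D := by
  obtain ⟨c, a, -, hZ, hest⟩ := exists_leadingCoeff_orderJump hD hne
  rw [hZ]
  obtain ⟨r, hr, C, -, h⟩ := hest y
  have h1 : Tendsto (fun k => ‖a (q k)‖) atTop (𝓝 ‖a y‖) :=
    ((continuous_leadingCoeff hest).tendsto y |>.comp hq).norm
  have h2 : Tendsto (fun k => C * ‖t k‖) atTop (𝓝 0) := by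
    simpa using (ht.norm.const_mul C)
  have h3 : ∀ᶠ k in atTop, ‖a (q k)‖ ≤ C * ‖t k‖ := by
    filter_upwards [hz, hq (Metric.ball_mem_nhds y hr), ht (Metric.ball_mem_nhds 0 hr)]
      with k hk1 hk2 hk3
    have h4 := (h _ hk2 _ hk3).2
    rw [hk1, zero_sub, norm_neg, norm_mul, norm_pow, pow_succ'] at h4
    have h5 : 0 < ‖t k‖ ^ c := pow_pos (norm_pos_iff.2 (ht0 k)) c
    rw [← mul_assoc] at h4
    exact le_of_mul_le_mul_right h4 h5
  exact norm_le_zero_iff.1 (le_of_tendsto_of_tendsto h1 h2 h3)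

/-- On the complex line from `y` to a point `q` with `a q ≠ 0`, the entire function `a` has an
isolated zero at `y`, hence is bounded below on a small circle around it. For small `t ≠ 0` the
function `D · t` is close to `a * t ^ c`: larger on the circle than at its centre, so it vanishes
inside. -/
theorem exists_zero_of_mem_orderJump [CompleteSpace E]
    (hD : ∀ y, AnalyticAt ℂ (fun x : E × ℂ => D x.1 x.2) (y, 0))
    (hne : ∃ y, analyticOrderAt (D y) 0 ≠ ⊤) {y : E} (hy : y ∈ orderJump D) :
    ∃ᶠ x in 𝓝 ((y, 0) : E × ℂ), x.2 ≠ 0 ∧ D x.1 x.2 = 0 := by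
  obtain ⟨c, a, ⟨q, hq⟩, hZ, hest⟩ := exists_leadingCoeff_orderJump hD hne
  rw [hZ] at hy
  rw [Metric.nhds_basis_ball.frequently_iff]
  intro ε hε
  obtain ⟨r, hr, C, hC, h⟩ := hest y
  have hb := differentiable_leadingCoeff_line hest y (q - y)
  set b : ℂ → ℂ := fun l => a (y + l • (q - y)) with hbdef
  have hb1 : b 1 ≠ 0 := by simpa [hbdef] using hq
  have hban : AnalyticOnNhd ℂ b Set.univ := fun l _ => hb.analyticAt l
  have hiso : ∀ᶠ l in 𝓝[≠] (0 : ℂ), b l ≠ 0 := by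
    refine (hb.analyticAt 0).eventually_eq_zero_or_eventually_ne_zero.resolve_left fun h0 => ?_
    exact hb1 (hban.eqOn_zero_of_preconnected_of_eventuallyEq_zero isPreconnected_univ
      (Set.mem_univ 0) h0 (Set.mem_univ 1))
  rw [eventually_nhdsWithin_iff] at hiso
  have hclose : ∀ᶠ l in 𝓝 (0 : ℂ), y + l • (q - y) ∈ Metric.ball y (min r ε) := by
    have hcont : Continuous fun l : ℂ => y + l • (q - y) := by fun_prop
    exact hcont.tendsto' 0 y (by simp) (Metric.ball_mem_nhds y (lt_min hr hε))
  obtain ⟨R, hR, hRball⟩ := Metric.nhds_basis_closedBall.eventually_iff.1 (hiso.and hclose)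
  obtain ⟨l₁, hl₁, hmin⟩ := (isCompact_sphere (0 : ℂ) R).exists_isMinOn
    (NormedSpace.sphere_nonempty.2 hR.le) (hb.continuous.norm.continuousOn)
  have hδ : 0 < ‖b l₁‖ := norm_pos_iff.2 ((hRball (Metric.sphere_subset_closedBall hl₁)).1
    (Metric.ne_of_mem_sphere hl₁ hR.ne'))
  -- With error at most a quarter of the minimum of `‖b‖` on the circle, `‖D‖ / ‖t‖ ^ c` is at least
  -- three quarters of it there and at most one quarter at the centre; the threshold used below is
  -- one half.
  obtain ⟨t, ht0, htr, hCt⟩ : ∃ t : ℂ, t ≠ 0 ∧ ‖t‖ < min r ε ∧ C * ‖t‖ < ‖b l₁‖ / 4 := by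
    have h1 : Tendsto (fun t : ℂ => C * ‖t‖) (𝓝 0) (𝓝 0) := by
      have : Continuous fun t : ℂ => C * ‖t‖ := by fun_prop
      simpa using this.tendsto 0
    have h2 : ∀ᶠ t in 𝓝[≠] (0 : ℂ), t ≠ 0 ∧ ‖t‖ < min r ε ∧ C * ‖t‖ < ‖b l₁‖ / 4 := by
      filter_upwards [self_mem_nhdsWithin,
        nhdsWithin_le_nhds (Metric.ball_mem_nhds (0 : ℂ) (lt_min hr hε)),
        nhdsWithin_le_nhds (h1.eventually (gt_mem_nhds (by positivity : 0 < ‖b l₁‖ / 4)))]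
        with t h3 h4 h5
      exact ⟨h3, mem_ball_zero_iff.1 h4, h5⟩
    exact h2.exists
  have htball : t ∈ Metric.ball (0 : ℂ) r := mem_ball_zero_iff.2 (htr.trans_le (min_le_left _ _))
  have hmem : ∀ l ∈ Metric.closedBall (0 : ℂ) R, y + l • (q - y) ∈ Metric.ball y r := fun l hl =>
    Metric.ball_subset_ball (min_le_left _ _) (hRball hl).2
  have hpow : 0 < ‖t‖ ^ c := pow_pos (norm_pos_iff.2 ht0) c
  have hest' : ∀ l ∈ Metric.closedBall (0 : ℂ) R,
      ‖D (y + l • (q - y)) t - b l * t ^ c‖ ≤ ‖b l₁‖ / 4 * ‖t‖ ^ c := fun l hl => by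
    refine (h _ (hmem l hl) t htball).2.trans ?_
    rw [pow_succ', ← mul_assoc]
    exact mul_le_mul_of_nonneg_right hCt.le hpow.le
  obtain ⟨l, hl, hzero⟩ := exists_zero_of_norm_lt (f := fun l => D (y + l • (q - y)) t)
    (ε := ‖b l₁‖ / 2 * ‖t‖ ^ c) hR (fun l hl => by
      have : DifferentiableAt ℂ (fun l : ℂ => D (y + l • (q - y)) t) l :=
        DifferentiableAt.comp (f := fun l : ℂ => (y + l • (q - y), t)) l
          (h _ (hmem l hl) t htball).1.differentiableAt (by fun_prop)
      exact this.differentiableWithinAt) (fun l hl => by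
      have h1 := hest' l (Metric.sphere_subset_closedBall hl)
      have h2 : ‖b l₁‖ * ‖t‖ ^ c ≤ ‖b l * t ^ c‖ := by
        rw [norm_mul, norm_pow]
        exact mul_le_mul_of_nonneg_right (hmin hl) hpow.le
      have h3 := norm_sub_norm_le (b l * t ^ c) (D (y + l • (q - y)) t)
      rw [norm_sub_rev] at h3
      nlinarith) (by
      have h1 := hest' 0 (Metric.mem_closedBall_self hR.le)
      have h2 : b 0 = 0 := by simpa [hbdef] using hy
      rw [h2, zero_mul, sub_zero] at h1
      nlinarith)
  refine ⟨(y + l • (q - y), t), ?_, ht0, hzero⟩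
  rw [← ball_prod_same]
  exact ⟨Metric.ball_subset_ball (min_le_right _ _) (hRball hl).2,
    mem_ball_zero_iff.2 (htr.trans_le (min_le_right _ _))⟩

end

/-! ### The resultant family of the pencil. -/

theorem Polynomial.resultant_monic_eq_zero_iff {P g : Polynomial ℂ} (hP : P.Monic) {n : ℕ}
    (hd : P.natDegree ≠ 0) (hg : g.natDegree ≤ n) :
    Polynomial.resultant P g P.natDegree n = 0 ↔ ∃ s, P.eval s = 0 ∧ g.eval s = 0 := by
  constructor
  · intro h
    -- The formal degree `n` may exceed the degree of `g`; the padding contributes only a power of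
    -- the leading coefficient of `P`, which is `1`.
    obtain ⟨k, rfl⟩ := Nat.exists_eq_add_of_le hg
    rw [Polynomial.resultant_add_right_deg _ _ _ _ _ le_rfl, hP.coeff_natDegree, one_pow, one_mul,
      Polynomial.resultant_eq_prod_eval _ _ _ le_rfl (IsAlgClosed.splits P), hP.leadingCoeff,
      one_pow, one_mul, Multiset.prod_eq_zero_iff, Multiset.mem_map] at h
    obtain ⟨s, hs, hs'⟩ := h
    exact ⟨s, (Polynomial.mem_roots'.1 hs).2, hs'⟩
  · rintro ⟨s, hs, hs'⟩
    obtain ⟨a, b, -, -, hab⟩ := Polynomial.exists_mul_add_mul_eq_C_resultant P g le_rfl hg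
      (Or.inl hd)
    have := congrArg (Polynomial.eval s) hab
    simpa [hs, hs'] using this.symm

/-- If `‖s‖ ≥ ε` and `ε ≤ 1`, then `‖s‖ ^ i * ε ^ d ≤ ‖s‖ ^ d` for `i < d`, so the lower terms are
too small to cancel `s ^ d`. -/
theorem Polynomial.norm_root_monicOfCoeffs_lt {d : ℕ} {p : Fin d → ℂ} {ε : ℝ} (hε : 0 < ε)
    (hε1 : ε ≤ 1) (hp : ∑ i, ‖p i‖ < ε ^ d) {s : ℂ}
    (hs : (Polynomial.monicOfCoeffs p).eval s = 0) : ‖s‖ < ε := by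
  by_contra! hle
  have hs0 : 0 < ‖s‖ := hε.trans_le hle
  have h1 : s ^ d = -∑ i, p i * s ^ (i : ℕ) := by
    rw [Polynomial.monicOfCoeffs, Polynomial.ofCoeffs, Polynomial.eval_add,
      Polynomial.eval_finsetSum] at hs
    simpa using eq_neg_of_add_eq_zero_left hs
  have h2 : ‖s‖ ^ d ≤ ∑ i, ‖p i‖ * ‖s‖ ^ (i : ℕ) := by
    rw [← norm_pow, h1, norm_neg]
    refine (norm_sum_le _ _).trans_eq ?_
    simp
  have h3 : ∀ i : Fin d, ‖s‖ ^ (i : ℕ) * ε ^ d ≤ ‖s‖ ^ d := by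
    intro i
    calc ‖s‖ ^ (i : ℕ) * ε ^ d ≤ ‖s‖ ^ (i : ℕ) * ε ^ (d - i) :=
          mul_le_mul_of_nonneg_left (pow_le_pow_of_le_one hε.le hε1 (Nat.sub_le _ _)) (by positivity)
      _ ≤ ‖s‖ ^ (i : ℕ) * ‖s‖ ^ (d - i) :=
          mul_le_mul_of_nonneg_left (pow_le_pow_left₀ hε.le hle _) (by positivity)
      _ = ‖s‖ ^ d := by rw [← pow_add, Nat.add_sub_cancel' i.2.le]
  have h4 : ‖s‖ ^ d * ε ^ d ≤ (∑ i, ‖p i‖) * ‖s‖ ^ d := by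
    calc ‖s‖ ^ d * ε ^ d ≤ (∑ i, ‖p i‖ * ‖s‖ ^ (i : ℕ)) * ε ^ d :=
          mul_le_mul_of_nonneg_right h2 (by positivity)
      _ = ∑ i, ‖p i‖ * (‖s‖ ^ (i : ℕ) * ε ^ d) := by
          rw [Finset.sum_mul]
          exact Finset.sum_congr rfl fun i _ => by ring
      _ ≤ ∑ i, ‖p i‖ * ‖s‖ ^ d :=
          Finset.sum_le_sum fun i _ => mul_le_mul_of_nonneg_left (h3 i) (norm_nonneg _)
      _ = _ := by rw [Finset.sum_mul]
  rw [mul_comm] at h4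
  exact absurd (le_of_mul_le_mul_right h4 (by positivity)) (not_le.2 hp)

theorem AnalyticAt.matrix_det {E ι : Type*} [NormedAddCommGroup E] [NormedSpace ℂ E] [Fintype ι]
    [DecidableEq ι] {A : E → Matrix ι ι ℂ} {x : E} (hA : ∀ i j, AnalyticAt ℂ (fun y => A y i j) x) :
    AnalyticAt ℂ (fun y => (A y).det) x := by
  simp only [Matrix.det_apply']
  refine Finset.analyticAt_fun_sum _ fun σ _ => analyticAt_const.mul ?_
  exact Finset.analyticAt_fun_prod _ fun i _ => hA _ _

theorem AnalyticAt.resultant {E : Type*} [NormedAddCommGroup E] [NormedSpace ℂ E]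
    {P Q : E → Polynomial ℂ} {x : E} (hP : ∀ k, AnalyticAt ℂ (fun y => (P y).coeff k) x)
    (hQ : ∀ k, AnalyticAt ℂ (fun y => (Q y).coeff k) x) (m n : ℕ) :
    AnalyticAt ℂ (fun y => Polynomial.resultant (P y) (Q y) m n) x := by
  refine AnalyticAt.matrix_det fun i j => ?_
  induction j using Fin.addCases with
  | left j =>
    simp only [Polynomial.sylvester, Matrix.of_apply, Fin.addCases_left]
    split_ifs
    · exact hQ _
    · exact analyticAt_const
  | right j =>
    simp only [Polynomial.sylvester, Matrix.of_apply, Fin.addCases_right]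
    split_ifs
    · exact hP _
    · exact analyticAt_const

theorem multiplicityAt_congr {g g' : Fin 2 → MvPolynomial (Fin 2) ℂ}
    (h : Set.range g = Set.range g') (z : Fin 2 → ℂ) :
    multiplicityAt g z = multiplicityAt g' z := by
  unfold multiplicityAt
  rw [h]

/-- The polynomials `G i - y i * z ^ M i`. -/
def pencil (G : Fin 2 → MvPolynomial (Fin 2) ℂ) (M : Fin 2 → Fin 2 →₀ ℕ) (y : Fin 2 → ℂ) :
    Fin 2 → MvPolynomial (Fin 2) ℂ :=
  fun i => G i - C (y i) * monomial (M i) 1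

section
variable (G : Fin 2 → MvPolynomial (Fin 2) ℂ) (M : Fin 2 → Fin 2 →₀ ℕ) (ρ : ℂ)

theorem eval_pencil (y z : Fin 2 → ℂ) (i : Fin 2) :
    eval z (pencil G M y i) = eval z (G i) - y i * (z 0 ^ M i 0 * z 1 ^ M i 1) := by
  simp [pencil, eval_monomial, Finsupp.prod_fintype]

theorem shiftEquiv_pencil (y : Fin 2 → ℂ) (i : Fin 2) :
    shiftEquiv ρ (pencil G M y i) = shiftEquiv ρ (G i) -
      Polynomial.C (Polynomial.C (y i) * Polynomial.X ^ M i 1) *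
        (Polynomial.X + Polynomial.C (Polynomial.C ρ)) ^ M i 0 := by
  have h1 : (monomial (M i) 1 : MvPolynomial (Fin 2) ℂ) = X 0 ^ M i 0 * X 1 ^ M i 1 := by
    rw [monomial_eq, Finsupp.prod_fintype _ _ (by simp)]
    simp
  have h2 : ∀ c : ℂ, shiftEquiv ρ (C c) = Polynomial.C (Polynomial.C c) := fun c =>
    (shiftEquiv ρ).commutes c
  have h3 : shiftEquiv ρ (X 0) = Polynomial.X + Polynomial.C (Polynomial.C ρ) := by
    simp [shiftEquiv]
  rw [pencil, h1, map_sub, map_mul, map_mul, map_pow, map_pow, h2, h3, shiftEquiv_X_one]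
  simp only [map_mul, map_pow]
  ring

theorem map_shiftEquiv_pencil (y : Fin 2 → ℂ) (i : Fin 2) (t : ℂ) :
    (shiftEquiv ρ (pencil G M y i)).map (Polynomial.evalRingHom t) =
      (shiftEquiv ρ (G i)).map (Polynomial.evalRingHom t) -
        Polynomial.C (y i * t ^ M i 1) * (Polynomial.X + Polynomial.C ρ) ^ M i 0 := by
  rw [shiftEquiv_pencil]
  simp

theorem natDegree_shiftEquiv_pencil_le (y : Fin 2 → ℂ) (i : Fin 2) :
    (shiftEquiv ρ (pencil G M y i)).natDegree ≤ max (shiftEquiv ρ (G i)).natDegree (M i 0) := by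
  rw [shiftEquiv_pencil]
  refine (Polynomial.natDegree_sub_le _ _).trans (max_le_max le_rfl ?_)
  refine (Polynomial.natDegree_C_mul_le _ _).trans ?_
  refine (Polynomial.natDegree_pow_le_of_le _ (Polynomial.natDegree_X_add_C _).le).trans ?_
  simp

theorem analyticAt_coeff_pencil (i : Fin 2) (k : ℕ) (x : (Fin 2 → ℂ) × ℂ) :
    AnalyticAt ℂ (fun x : (Fin 2 → ℂ) × ℂ =>
      ((shiftEquiv ρ (pencil G M x.1 i)).map (Polynomial.evalRingHom x.2)).coeff k) x := by
  simp only [map_shiftEquiv_pencil, Polynomial.coeff_sub, Polynomial.coeff_C_mul,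
    Polynomial.coeff_map, Polynomial.coe_evalRingHom]
  have h1 : AnalyticAt ℂ (fun x : (Fin 2 → ℂ) × ℂ =>
      ((shiftEquiv ρ (G i)).coeff k).eval x.2) x :=
    AnalyticAt.comp (f := fun x : (Fin 2 → ℂ) × ℂ => x.2)
      (((shiftEquiv ρ (G i)).coeff k).differentiable.analyticAt x.2) analyticAt_snd
  have h2 : AnalyticAt ℂ (fun x : (Fin 2 → ℂ) × ℂ => x.1 i) x :=
    ((ContinuousLinearMap.proj i : (Fin 2 → ℂ) →L[ℂ] ℂ).analyticAt _).comp analyticAt_fst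
  exact h1.sub ((h2.mul (analyticAt_snd.pow _)).mul analyticAt_const)

variable {G M ρ}

/-- The resultant of the Weierstrass factor of one member of the pencil and of the other member:
its order in the last variable is the multiplicity, and its zeros are the values for which there
is a nearby solution. -/
theorem exists_resultant_family {i j : Fin 2} (hij : i ≠ j) (hM : M i 1 ≠ 0)
    (hG : (shiftEquiv ρ (G i)).map (Polynomial.evalRingHom 0) ≠ 0)
    (hs : eval ![ρ, 0] (G i) = 0) :
    ∃ D : (Fin 2 → ℂ) → ℂ → ℂ,
      (∀ y, AnalyticAt ℂ (fun x : (Fin 2 → ℂ) × ℂ => D x.1 x.2) (y, 0)) ∧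
      (∀ y, multiplicityAt (pencil G M y) ![ρ, 0] = analyticOrderAt (D y) 0) ∧
      (∀ y, ∀ᶠ x in 𝓝 ((y, 0, 0) : (Fin 2 → ℂ) × ℂ × ℂ),
        (∀ k, eval ![x.2.1 + ρ, x.2.2] (pencil G M x.1 k) = 0) → D x.1 x.2.2 = 0) ∧
      (∀ y, ∀ ε > 0, ∀ᶠ x in 𝓝 ((y, 0) : (Fin 2 → ℂ) × ℂ), D x.1 x.2 = 0 →
        ∃ s : ℂ, ‖s‖ < ε ∧ ∀ k, eval ![s + ρ, x.2] (pencil G M x.1 k) = 0) := by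
  have hcases : ∀ k : Fin 2, k = i ∨ k = j := by
    intro k
    fin_cases i <;> fin_cases j <;> fin_cases k <;> simp_all
  set f₀ := (shiftEquiv ρ (G i)).map (Polynomial.evalRingHom 0) with hf₀
  obtain ⟨u₀, hu₀, hu₀'⟩ := Polynomial.exists_eq_pow_rootMultiplicity_mul_and_not_dvd f₀ hG 0
  rw [map_zero, sub_zero] at hu₀ hu₀'
  set d := f₀.rootMultiplicity 0 with hd
  have hd0 : d ≠ 0 := by
    have h1 : f₀.eval 0 = 0 := by
      rw [hf₀, eval_shiftEquiv, zero_add, hs]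
    exact ((Polynomial.rootMultiplicity_pos hG).2 h1).ne'
  -- A degree bound valid for all `y`; the extra `1` turns it into the strict bound required by
  -- `degreeLT`.
  set k := max (shiftEquiv ρ (G i)).natDegree (M i 0) + 1 with hk
  set n := max (shiftEquiv ρ (G j)).natDegree (M j 0) with hn
  let γ : Fin 2 → (Fin 2 → ℂ) × ℂ → Polynomial ℂ := fun l x =>
    (shiftEquiv ρ (pencil G M x.1 l)).map (Polynomial.evalRingHom x.2)
  let V : (Fin 2 → ℂ) × ℂ → Fin (d + k) → ℂ := fun x l => (γ i x).coeff l
  have hVan : ∀ x, AnalyticAt ℂ V x := fun x => by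
    rw [analyticAt_pi_iff]
    exact fun l => analyticAt_coeff_pencil G M ρ i l x
  have hV : ∀ x, Polynomial.ofCoeffs (V x) = γ i x := by
    intro x
    refine Polynomial.ofCoeffs_coeff (Polynomial.mem_degreeLT.2 ?_)
    refine (Polynomial.degree_le_natDegree.trans (Nat.cast_le.2 (Polynomial.natDegree_map_le.trans
      (natDegree_shiftEquiv_pencil_le G M ρ x.1 i)))).trans_lt ?_
    exact_mod_cast (by omega : max (shiftEquiv ρ (G i)).natDegree (M i 0) < d + k)
  -- Because `M i 1 ≠ 0`, the term with `y i` vanishes on `z 1 = 0`. Hence one factorization near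
  -- the coefficient vector of `f₀` serves at every point `(y, 0)`.
  have hγ0 : ∀ y, γ i (y, 0) = f₀ := by
    intro y
    simp only [γ, map_shiftEquiv_pencil, zero_pow hM, mul_zero, map_zero, zero_mul, sub_zero, hf₀]
  let u : Fin k → ℂ := fun l => u₀.coeff l
  have hu : Polynomial.ofCoeffs u = u₀ := by
    refine Polynomial.ofCoeffs_coeff (Polynomial.mem_degreeLT.2 ?_)
    have h1 : u₀.natDegree ≤ (shiftEquiv ρ (G i)).natDegree :=
      (Polynomial.natDegree_le_of_dvd ⟨_, hu₀.trans (mul_comm _ _)⟩ hG).trans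
        Polynomial.natDegree_map_le
    refine (Polynomial.degree_le_natDegree.trans (Nat.cast_le.2 h1)).trans_lt ?_
    exact_mod_cast (by omega : (shiftEquiv ρ (G i)).natDegree < k)
  have huc : (Polynomial.ofCoeffs u).coeff 0 ≠ 0 := by
    rw [hu]
    rwa [Polynomial.X_dvd_iff] at hu₀'
  obtain ⟨p, q, hp, hq, hp0, hq0, hfac⟩ := exists_analytic_factorization d u huc
  set v₀ := mulCoeffs d k (0, u) with hv₀
  have hV0 : ∀ y, V (y, 0) = v₀ := by
    intro y
    apply Polynomial.ofCoeffs_injective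
    rw [hV, hγ0, hv₀, ofCoeffs_mulCoeffs, hu, hu₀]
    simp [Polynomial.monicOfCoeffs, Polynomial.ofCoeffs]
  have hpV : ∀ y, AnalyticAt ℂ (fun x => p (V x)) (y, 0) := fun y =>
    AnalyticAt.comp (f := V) (by rw [hV0]; exact hp) (hVan _)
  have hqV : ∀ y, AnalyticAt ℂ (fun x => q (V x)) (y, 0) := fun y =>
    AnalyticAt.comp (f := V) (by rw [hV0]; exact hq) (hVan _)
  have hfacV : ∀ y, ∀ᶠ x in 𝓝 ((y, 0) : (Fin 2 → ℂ) × ℂ),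
      γ i x = Polynomial.monicOfCoeffs (p (V x)) * Polynomial.ofCoeffs (q (V x)) := by
    intro y
    have h1 : Tendsto V (𝓝 (y, 0)) (𝓝 v₀) := by
      rw [← hV0 y]
      exact (hVan _).continuousAt
    filter_upwards [h1.eventually hfac] with x hx
    rw [hx, hV]
  have hdeg : ∀ x, (Polynomial.monicOfCoeffs (p (V x))).natDegree = d := fun x =>
    Polynomial.natDegree_monicOfCoeffs _
  have hnle : ∀ x, (γ j x).natDegree ≤ n := fun x =>
    Polynomial.natDegree_map_le.trans (natDegree_shiftEquiv_pencil_le G M ρ x.1 j)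
  have hres : ∀ x, Polynomial.resultant (Polynomial.monicOfCoeffs (p (V x))) (γ j x) d n = 0 ↔
      ∃ s, (Polynomial.monicOfCoeffs (p (V x))).eval s = 0 ∧ (γ j x).eval s = 0 := by
    intro x
    have h1 := Polynomial.resultant_monic_eq_zero_iff
      (Polynomial.monicOfCoeffs_monic (p (V x))) (by rwa [hdeg]) (hnle x)
    rwa [hdeg] at h1
  have hγeval : ∀ l x s, (γ l x).eval s = eval ![s + ρ, x.2] (pencil G M x.1 l) := fun l x s =>
    eval_shiftEquiv ρ s x.2 _
  refine ⟨fun y t => Polynomial.resultant (Polynomial.monicOfCoeffs (p (V (y, t)))) (γ j (y, t)) d n,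
    fun y => ?_, fun y => ?_, fun y => ?_, fun y ε hε => ?_⟩
  · refine AnalyticAt.resultant (fun l => ?_) (fun l => analyticAt_coeff_pencil G M ρ j l _) d n
    simp only [Polynomial.monicOfCoeffs, Polynomial.coeff_add, Polynomial.coeff_ofCoeffs]
    split_ifs with h
    · exact analyticAt_const.add ((analyticAt_pi_iff.1 (hpV y)) ⟨l, h⟩)
    · exact analyticAt_const
  · have h1 : multiplicityAt (pencil G M y) ![ρ, 0] =
        multiplicityAt ![pencil G M y i, pencil G M y j] ![ρ, 0] := by
      have h2 : Set.range (pencil G M y) = Set.range ![pencil G M y i, pencil G M y j] := by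
        ext h
        simp only [Set.mem_range, Fin.exists_fin_two, Matrix.cons_val_zero, Matrix.cons_val_one]
        constructor
        · rintro (h | h)
          · rcases hcases 0 with h3 | h3 <;> rw [h3] at h <;> simp [h]
          · rcases hcases 1 with h3 | h3 <;> rw [h3] at h <;> simp [h]
        · intro h3
          rw [← Fin.exists_fin_two (p := fun l => pencil G M y l = h)]
          exact h3.elim (fun h => ⟨_, h⟩) fun h => ⟨_, h⟩
      exact multiplicityAt_congr h2 _
    have hline : AnalyticAt ℂ (fun t : ℂ => (y, t)) 0 := by fun_prop
    rw [h1]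
    refine multiplicityAt_eq_analyticOrderAt (fun t => p (V (y, t))) (fun t => q (V (y, t)))
      (fun l => ?_) (fun l => ?_) hd0 ?_ ?_ ?_ ?_
    · exact (analyticAt_pi_iff.1 (AnalyticAt.comp (f := fun t : ℂ => (y, t)) (hpV y) hline)) l
    · exact (analyticAt_pi_iff.1 (AnalyticAt.comp (f := fun t : ℂ => (y, t)) (hqV y) hline)) l
    · simp only [hV0, hp0]
    · simp only [hV0, hq0, huc, ne_eq, not_false_eq_true]
    · exact hline.continuousAt.eventually (hfacV y)
    · exact natDegree_shiftEquiv_pencil_le G M ρ y j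
  · have hpr : Tendsto (fun x : (Fin 2 → ℂ) × ℂ × ℂ => (x.1, x.2.2)) (𝓝 (y, 0, 0)) (𝓝 (y, 0)) :=
      Continuous.tendsto (by fun_prop) _
    have hQ : ContinuousAt (fun x : (Fin 2 → ℂ) × ℂ × ℂ =>
        (Polynomial.ofCoeffs (q (V (x.1, x.2.2)))).eval x.2.1) (y, 0, 0) := by
      simp only [Polynomial.ofCoeffs, Polynomial.eval_finsetSum, Polynomial.eval_mul,
        Polynomial.eval_C, Polynomial.eval_pow, Polynomial.eval_X]
      refine tendsto_finsetSum _ fun l _ => ContinuousAt.mul ?_ (by fun_prop)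
      exact ContinuousAt.comp (f := fun x : (Fin 2 → ℂ) × ℂ × ℂ => (x.1, x.2.2))
        (analyticAt_pi_iff.1 (hqV y) l).continuousAt hpr
    -- The cofactor does not vanish near the origin, so nearby zeros of the `i`-th polynomial are
    -- zeros of its Weierstrass factor.
    have hQ0 : (Polynomial.ofCoeffs (q (V (y, 0)))).eval 0 ≠ 0 := by
      rwa [hV0, hq0, ← Polynomial.coeff_zero_eq_eval_zero]
    filter_upwards [hpr.eventually (hfacV y), hQ.eventually_ne hQ0] with x h1 h2 h3
    refine (hres _).2 ⟨x.2.1, ?_, ?_⟩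
    · have h4 : (γ i (x.1, x.2.2)).eval x.2.1 = 0 := by rw [hγeval, h3]
      rw [h1, Polynomial.eval_mul] at h4
      exact (mul_eq_zero.1 h4).resolve_right h2
    · rw [hγeval, h3]
  · have hε' : 0 < min ε 1 := lt_min hε one_pos
    -- The lower Weierstrass coefficients tend to `0`, so every root of the factor, in particular a
    -- common root, is close to `0`.
    have h1 : Tendsto (fun x => ∑ l, ‖p (V x) l‖) (𝓝 ((y, 0) : (Fin 2 → ℂ) × ℂ)) (𝓝 0) := by
      have h2 : ContinuousAt (fun x => ∑ l, ‖p (V x) l‖) ((y, 0) : (Fin 2 → ℂ) × ℂ) :=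
        tendsto_finsetSum _ fun l _ => (analyticAt_pi_iff.1 (hpV y) l).continuousAt.norm
      have h3 := h2.tendsto
      simpa [hV0, hp0] using h3
    filter_upwards [hfacV y, h1.eventually (gt_mem_nhds (pow_pos hε' d))] with x h2 h3 h4
    obtain ⟨s, hs1, hs2⟩ := (hres _).1 h4
    refine ⟨s, (Polynomial.norm_root_monicOfCoeffs_lt hε' (min_le_right _ _) h3 hs1).trans_le
      (min_le_left _ _), fun l => ?_⟩
    rw [← hγeval l x]
    rcases hcases l with rfl | rfl
    · rw [h2, Polynomial.eval_mul, hs1, zero_mul]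
    · exact hs2

end

/-! ### Limits of solutions and multiplicity jumps. -/

section
variable {G : Fin 2 → MvPolynomial (Fin 2) ℂ} {M : Fin 2 → Fin 2 →₀ ℕ} {ρ : ℂ}

theorem exists_analyticOrderAt_ne_top {i j : Fin 2} (hij : i ≠ j) (hρ : ρ ≠ 0)
    (hG : (shiftEquiv ρ (G i)).map (Polynomial.evalRingHom 0) ≠ 0)
    {D : (Fin 2 → ℂ) → ℂ → ℂ}
    (hD : ∀ y, AnalyticAt ℂ (fun x : (Fin 2 → ℂ) × ℂ => D x.1 x.2) (y, 0))
    (hzero : ∀ y, ∀ ε > 0, ∀ᶠ x in 𝓝 ((y, 0) : (Fin 2 → ℂ) × ℂ), D x.1 x.2 = 0 →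
        ∃ s : ℂ, ‖s‖ < ε ∧ ∀ k, eval ![s + ρ, x.2] (pencil G M x.1 k) = 0) :
    ∃ y, analyticOrderAt (D y) 0 ≠ ⊤ := by
  by_contra! htop
  obtain ⟨r, hr, B, -, hball⟩ := (hD 0).exists_ball_bound
  have hDzero : ∀ y ∈ Metric.ball (0 : Fin 2 → ℂ) r, ∀ t ∈ Metric.ball (0 : ℂ) r, D y t = 0 := by
    intro y hy
    have h1 : AnalyticOnNhd ℂ (D y) (Metric.ball 0 r) := fun t ht =>
      AnalyticAt.comp (f := fun t : ℂ => (y, t)) (hball y hy t ht).2 (by fun_prop)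
    exact h1.eqOn_zero_of_preconnected_of_eventuallyEq_zero (convex_ball _ _).isPreconnected
      (Metric.mem_ball_self hr) (analyticOrderAt_eq_top.1 (htop y))
  obtain ⟨r', hr', hball'⟩ := Metric.eventually_nhds_iff_ball.1 (hzero 0 ‖ρ‖ (norm_pos_iff.2 hρ))
  obtain ⟨l, hl⟩ : ∃ l, ((shiftEquiv ρ (G i)).coeff l).eval 0 ≠ 0 := by
    by_contra! h
    refine hG (Polynomial.ext fun l => ?_)
    rw [Polynomial.coeff_map, Polynomial.coeff_zero]
    exact h l
  have hne : ∀ᶠ t in 𝓝 (0 : ℂ), ((shiftEquiv ρ (G i)).coeff l).eval t ≠ 0 :=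
    ((shiftEquiv ρ (G i)).coeff l).continuous.continuousAt.eventually_ne hl
  obtain ⟨t, ht0, htr, htl⟩ : ∃ t : ℂ, t ≠ 0 ∧ ‖t‖ < min r r' ∧
      ((shiftEquiv ρ (G i)).coeff l).eval t ≠ 0 := by
    have h2 : ∀ᶠ t in 𝓝[≠] (0 : ℂ), t ≠ 0 ∧ ‖t‖ < min r r' ∧
        ((shiftEquiv ρ (G i)).coeff l).eval t ≠ 0 := by
      filter_upwards [self_mem_nhdsWithin, nhdsWithin_le_nhds hne,
        nhdsWithin_le_nhds (Metric.ball_mem_nhds (0 : ℂ) (lt_min hr hr'))] with t h3 h4 h5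
      exact ⟨h3, mem_ball_zero_iff.1 h5, h4⟩
    exact h2.exists
  have hpoly : (shiftEquiv ρ (G i)).map (Polynomial.evalRingHom t) ≠ 0 := by
    intro h
    apply htl
    have := congrArg (fun f => Polynomial.coeff f l) h
    simpa [Polynomial.coeff_map] using this
  have hsub : Metric.ball (0 : ℂ) (min r r') ⊆
      (fun s => eval ![s + ρ, t] (G j) / ((s + ρ) ^ M j 0 * t ^ M j 1)) ''
        {s | ((shiftEquiv ρ (G i)).map (Polynomial.evalRingHom t)).IsRoot s} := by
    intro w hw
    have hy : ‖(Pi.single j w : Fin 2 → ℂ)‖ < min r r' := by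
      rw [Pi.norm_single]
      exact mem_ball_zero_iff.1 hw
    have h1 := hDzero (Pi.single j w) (mem_ball_zero_iff.2 (hy.trans_le (min_le_left _ _))) t
      (mem_ball_zero_iff.2 (htr.trans_le (min_le_left _ _)))
    obtain ⟨s, hs, hs'⟩ := hball' (Pi.single j w, t) (by
      rw [← ball_prod_same]
      exact ⟨mem_ball_zero_iff.2 (hy.trans_le (min_le_right _ _)),
        mem_ball_zero_iff.2 (htr.trans_le (min_le_right _ _))⟩) h1
    have hsρ : s + ρ ≠ 0 := by
      intro h
      rw [eq_neg_of_add_eq_zero_left h, norm_neg] at hs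
      exact lt_irrefl _ hs
    refine ⟨s, ?_, ?_⟩
    · have h2 := hs' i
      rw [eval_pencil] at h2
      simp only [Pi.single_eq_of_ne hij, zero_mul, sub_zero] at h2
      rw [Set.mem_ofPred_eq, Polynomial.IsRoot.def, eval_shiftEquiv, h2]
    · have h2 := hs' j
      rw [eval_pencil] at h2
      simp only [Pi.single_eq_same, Matrix.cons_val_zero, Matrix.cons_val_one] at h2
      change eval ![s + ρ, t] (G j) / ((s + ρ) ^ M j 0 * t ^ M j 1) = w
      rw [div_eq_iff (mul_ne_zero (pow_ne_zero _ hsρ) (pow_ne_zero _ ht0))]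
      exact sub_eq_zero.1 h2
  have hfin : (Metric.ball (0 : ℂ) (min r r')).Finite :=
    ((Polynomial.finite_setOfPred_isRoot hpoly).image _).subset hsub
  exact (infinite_of_mem_nhds (0 : ℂ) (Metric.ball_mem_nhds _ (lt_min hr hr'))) hfin

/-- The limits of the values with solutions in the torus near `(ρ, 0)` are the values at which the
multiplicity jumps. -/
theorem closure_limit_eq_multiplicity_jump {i j : Fin 2} (hij : i ≠ j) (hM : M i 1 ≠ 0)
    (hρ : ρ ≠ 0) (hG : (shiftEquiv ρ (G i)).map (Polynomial.evalRingHom 0) ≠ 0)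
    (hs : eval ![ρ, 0] (G i) = 0) :
    closure {y : Fin 2 → ℂ | (∀ k, eval ![ρ, 0] (pencil G M y k) = 0) ∧
      ∃ (z : ℕ → Fin 2 → ℂ) (q : ℕ → Fin 2 → ℂ),
        (∀ k l, z k l ≠ 0) ∧ Tendsto z atTop (𝓝 ![ρ, 0]) ∧ Tendsto q atTop (𝓝 y) ∧
          ∀ k l, eval (z k) (pencil G M (q k) l) = 0} =
    {y | ∃ q, multiplicityAt (pencil G M q) ![ρ, 0] < multiplicityAt (pencil G M y) ![ρ, 0]} := by
  obtain ⟨D, hD, hmult, hDsol, hsolD⟩ := exists_resultant_family hij hM hG hs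
  have hne := exists_analyticOrderAt_ne_top hij hρ hG hD hsolD
  have hjump : {y | ∃ q, multiplicityAt (pencil G M q) ![ρ, 0] <
      multiplicityAt (pencil G M y) ![ρ, 0]} = orderJump D := by
    simp only [hmult, orderJump]
  have hz2 : ∀ z : Fin 2 → ℂ, ![z 0 - ρ + ρ, z 1] = z := fun z => by
    ext k
    fin_cases k <;> simp
  rw [hjump]
  apply subset_antisymm
  · refine closure_minimal ?_ (isClosed_orderJump hD hne)
    rintro y ⟨-, z, q, hz0, hz, hq, hsol⟩
    have hz0' : Tendsto (fun k => z k 0 - ρ) atTop (𝓝 0) := by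
      have := ((tendsto_pi_nhds.1 hz) 0).sub_const ρ
      simpa using this
    have hz1 : Tendsto (fun k => z k 1) atTop (𝓝 0) := by
      simpa using (tendsto_pi_nhds.1 hz) 1
    refine mem_orderJump_of_tendsto hD hne hq hz1 (fun k => hz0 k 1) ?_
    have h1 : Tendsto (fun k => (q k, z k 0 - ρ, z k 1)) atTop (𝓝 (y, 0, 0)) :=
      hq.prodMk_nhds (hz0'.prodMk_nhds hz1)
    filter_upwards [h1.eventually (hDsol y)] with k hk
    refine hk fun l => ?_
    simp only [hz2]
    exact hsol k l
  · refine subset_trans (fun y hy => ?_) subset_closure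
    have hfreq := exists_zero_of_mem_orderJump hD hne hy
    have hex : ∀ k : ℕ, ∃ (z q : Fin 2 → ℂ), (∀ l, z l ≠ 0) ∧
        dist z ![ρ, 0] < 1 / ((k : ℝ) + 1) ∧ dist q y < 1 / ((k : ℝ) + 1) ∧
        ∀ l, eval z (pencil G M q l) = 0 := by
      intro k
      have hk : (0 : ℝ) < 1 / ((k : ℝ) + 1) := Nat.one_div_pos_of_nat
      -- The bound `‖s‖ < ‖ρ‖` keeps `s + ρ` non-zero, so the solution lies in the torus.
      have h2 := hfreq.and_eventually ((hsolD y (min ‖ρ‖ (1 / ((k : ℝ) + 1)))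
        (lt_min (norm_pos_iff.2 hρ) hk)).and (Metric.ball_mem_nhds (y, 0) hk))
      obtain ⟨⟨q, t⟩, ⟨ht0, hDt⟩, hsol, hball⟩ := h2.exists
      obtain ⟨s, hs1, hs2⟩ := hsol hDt
      rw [Prod.dist_eq, max_lt_iff] at hball
      have hsρ : s + ρ ≠ 0 := by
        intro h
        rw [eq_neg_of_add_eq_zero_left h, norm_neg] at hs1
        exact lt_irrefl _ (hs1.trans_le (min_le_left _ _))
      refine ⟨![s + ρ, t], q, ?_, ?_, hball.1, hs2⟩
      · intro l
        fin_cases l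
        · exact hsρ
        · exact ht0
      · rw [dist_pi_lt_iff hk]
        intro l
        fin_cases l
        · simpa [dist_eq_norm] using hs1.trans_le (min_le_right _ _)
        · exact hball.2
    choose z q hz0 hz hq hsol using hex
    have hzt : Tendsto z atTop (𝓝 ![ρ, 0]) :=
      tendsto_iff_dist_tendsto_zero.2 (squeeze_zero (fun _ => dist_nonneg) (fun k => (hz k).le)
        tendsto_one_div_add_atTop_nhds_zero_nat)
    have hqt : Tendsto q atTop (𝓝 y) :=
      tendsto_iff_dist_tendsto_zero.2 (squeeze_zero (fun _ => dist_nonneg) (fun k => (hq k).le)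
        tendsto_one_div_add_atTop_nhds_zero_nat)
    -- That `(ρ, 0)` solves the system of `y` itself follows by continuity from the approximating
    -- solutions.
    refine ⟨fun l => ?_, z, q, hz0, hzt, hqt, hsol⟩
    have h3 : Tendsto (fun k => eval (z k) (pencil G M (q k) l)) atTop
        (𝓝 (eval ![ρ, 0] (pencil G M y l))) := by
      simp only [eval_pencil]
      refine Tendsto.sub (((MvPolynomial.continuous_eval (G l)).tendsto _).comp hzt)
        (((tendsto_pi_nhds.1 hqt) l).mul ?_)
      exact (((tendsto_pi_nhds.1 hzt) 0).pow _).mul (((tendsto_pi_nhds.1 hzt) 1).pow _)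
    simp only [hsol] at h3
    exact (tendsto_nhds_unique h3 tendsto_const_nhds)

theorem multiplicityAt_eq_zero {g : Fin 2 → MvPolynomial (Fin 2) ℂ} {z : Fin 2 → ℂ} {i : Fin 2}
    (h : eval z (g i) ≠ 0) : multiplicityAt g z = 0 := by
  have htop : (Ideal.span (Set.range g)).map
      (algebraMap (MvPolynomial (Fin 2) ℂ) (Localization.AtPrime (pointIdeal z))) = ⊤ := by
    refine Ideal.eq_top_of_isUnit_mem _ (Ideal.mem_map_of_mem _ (Ideal.subset_span ⟨i, rfl⟩)) ?_
    exact IsLocalization.map_units _ (⟨g i, h⟩ : (pointIdeal z).primeCompl)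
  unfold multiplicityAt
  rw [htop, Cardinal.toENat_eq_zero]
  exact rank_subsingleton' _ _

theorem multiplicityAt_ne_zero {g : Fin 2 → MvPolynomial (Fin 2) ℂ} {z : Fin 2 → ℂ}
    (h : ∀ i, eval z (g i) = 0) : multiplicityAt g z ≠ 0 := by
  have hle : (Ideal.span (Set.range g)).map
      (algebraMap (MvPolynomial (Fin 2) ℂ) (Localization.AtPrime (pointIdeal z))) ≤
        IsLocalRing.maximalIdeal (Localization.AtPrime (pointIdeal z)) := by
    rw [← Localization.AtPrime.map_eq_maximalIdeal]
    refine Ideal.map_mono (Ideal.span_le.2 ?_)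
    rintro _ ⟨i, rfl⟩
    exact h i
  have : Nontrivial (Localization.AtPrime (pointIdeal z) ⧸ (Ideal.span (Set.range g)).map
      (algebraMap (MvPolynomial (Fin 2) ℂ) (Localization.AtPrime (pointIdeal z)))) := by
    rw [Ideal.Quotient.nontrivial_iff]
    exact fun htop => (IsLocalRing.maximalIdeal.isMaximal _).ne_top (top_le_iff.1 (htop ▸ hle))
  unfold multiplicityAt
  rw [Ne, Cardinal.toENat_eq_zero]
  exact ne_of_gt rank_pos

end

/-! ### Toric transforms as pencils, and their constant terms. -/

/-- The exponent of the monomial of `Ū p` that is the image of `x ^ a`. -/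
def clearedExp (U : Matrix (Fin 2) (Fin 2) ℤ) (p : MvPolynomial (Fin 2) ℂ) (a : Fin 2 →₀ ℕ) :
    Fin 2 →₀ ℕ :=
  Finsupp.equivFunOnFinite.symm fun j => (toricExp U a j - minExp U p j).toNat

/-- The exponent `0` lies in the support of `p`, so subtracting `c` adds no exponent; if `c` cancels
the constant term, the extra summand is zero. -/
theorem toricTransform_eq_sum {U : Matrix (Fin 2) (Fin 2) ℤ} {p : MvPolynomial (Fin 2) ℂ}
    (hp : eval 0 p ≠ 0) (c : ℂ) :
    toricTransform U p c = ∑ a ∈ p.support, monomial (clearedExp U p a) (coeff a (p - C c)) := by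
  refine Finset.sum_subset (fun a ha => ?_) fun a _ ha => ?_
  · by_cases h : a = 0
    · subst h
      have h2 : constantCoeff p ≠ 0 := by simpa [MvPolynomial.eval_zero] using hp
      simpa [MvPolynomial.mem_support_iff, constantCoeff_eq] using h2
    · rw [MvPolynomial.mem_support_iff] at ha ⊢
      simpa [coeff_C, Ne.symm h] using ha
  · rw [notMem_support_iff.1 ha, map_zero]

theorem toricTransform_eq_pencil {U : Matrix (Fin 2) (Fin 2) ℤ}
    {f : Fin 2 → MvPolynomial (Fin 2) ℂ} (hf : ∀ i, eval 0 (f i) ≠ 0) (y : Fin 2 → ℂ) (i : Fin 2) :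
    toricTransform U (f i) (y i) =
      pencil (fun i => toricTransform U (f i) 0) (fun i => clearedExp U (f i) 0) y i := by
  have hmem : (0 : Fin 2 →₀ ℕ) ∈ (f i).support := by
    have h2 : constantCoeff (f i) ≠ 0 := by simpa [MvPolynomial.eval_zero] using hf i
    simpa [MvPolynomial.mem_support_iff, constantCoeff_eq] using h2
  simp only [pencil, toricTransform_eq_sum (hf i), coeff_sub, map_sub, Finset.sum_sub_distrib,
    map_zero, sub_zero]
  rw [Finset.sum_eq_single_of_mem (f := fun a => monomial (clearedExp U (f i) a) (coeff a (C (y i))))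
    0 hmem fun a _ ha => by rw [coeff_C, if_neg ha.symm, map_zero],
    coeff_C, if_pos rfl, C_mul_monomial, mul_one]

theorem toricExp_injective {U : Matrix (Fin 2) (Fin 2) ℤ} (hU : IsUnit U.det) :
    Function.Injective (toricExp U) := by
  intro a b h
  have h2 := Matrix.mulVec_injective_of_isUnit ((Matrix.isUnit_iff_isUnit_det U).2 hU) h
  ext j
  exact_mod_cast congrFun h2 j

theorem isUnit_det_of_mem_toricTransformations {A Γ : Set (Fin 2 → ℝ)}
    {U : Matrix (Fin 2) (Fin 2) ℤ} (hU : U ∈ toricTransformations A Γ) : IsUnit U.det := by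
  obtain ⟨a, v, w, h, rfl⟩ := hU
  rw [Matrix.det_transpose]
  exact Matrix.isUnit_nonsing_inv_det _ h.basis

/-- The coordinates of a `Γ`-toric transformation attain their minimum on `A` at one point. -/
theorem exists_forall_mulVec_le {A Γ : Set (Fin 2 → ℝ)} {U : Matrix (Fin 2) (Fin 2) ℤ}
    (hΓ : Γ ⊆ A) (hU : U ∈ toricTransformations A Γ) :
    ∃ x ∈ A, ∀ y ∈ A, ∀ j, (U.map (Int.cast : ℤ → ℝ) *ᵥ x) j ≤
      (U.map (Int.cast : ℤ → ℝ) *ᵥ y) j := by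
  obtain ⟨a, v, w, h, rfl⟩ := hU
  refine ⟨toReal a, hΓ h.vertex.1, fun y hy => ?_⟩
  obtain ⟨b₁, b₂, h₁, h₂, hb⟩ := h.cone y hy
  have hmul := Matrix.mul_nonsing_inv _ h.basis
  set V := ((Matrix.of ![v, w])⁻¹)ᵀ with hV
  -- Since `V` sends `v, w` to the standard basis, the coordinates of `V (y - a)` are the cone
  -- coefficients `b₁, b₂ ≥ 0`.
  have hv : V.map (Int.cast : ℤ → ℝ) *ᵥ toReal v = ![1, 0] := by
    ext j
    have := congrArg (Int.cast : ℤ → ℝ) (congrFun (congrFun hmul 0) j)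
    simp [Matrix.mul_apply, Fin.sum_univ_two] at this
    simp [Matrix.mulVec, dotProduct, Fin.sum_univ_two, toReal, hV, mul_comm, this]
    fin_cases j <;> simp [Matrix.one_apply]
  have hw : V.map (Int.cast : ℤ → ℝ) *ᵥ toReal w = ![0, 1] := by
    ext j
    have := congrArg (Int.cast : ℤ → ℝ) (congrFun (congrFun hmul 1) j)
    simp [Matrix.mul_apply, Fin.sum_univ_two] at this
    simp [Matrix.mulVec, dotProduct, Fin.sum_univ_two, toReal, hV, mul_comm, this]
    fin_cases j <;> simp [Matrix.one_apply]
  have key := congrArg (V.map (Int.cast : ℤ → ℝ) *ᵥ ·) hb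
  simp only [Matrix.mulVec_sub, Matrix.mulVec_add, Matrix.mulVec_smul, hv, hw] at key
  intro j
  have := congrFun key j
  fin_cases j
  · simp at this ⊢
    linarith
  · simp at this ⊢
    linarith

/-- The sum of the two coordinates is linear, so some support point has a sum no larger than that of
`x`. Each of its coordinates is at least that of `x`, which forces equality in both. -/
theorem exists_mem_support_forall_toricExp_le {U : Matrix (Fin 2) (Fin 2) ℤ}
    {p : MvPolynomial (Fin 2) ℂ} {x : Fin 2 → ℝ} (hx : x ∈ newtonPolygon p)
    (hmin : ∀ y ∈ newtonPolygon p, ∀ j, (U.map (Int.cast : ℤ → ℝ) *ᵥ x) j ≤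
      (U.map (Int.cast : ℤ → ℝ) *ᵥ y) j) :
    ∃ a ∈ p.support, ∀ b ∈ p.support, ∀ j, toricExp U a j ≤ toricExp U b j := by
  set V := U.map (Int.cast : ℤ → ℝ)
  have hcast : ∀ (b : Fin 2 →₀ ℕ) j, (V *ᵥ fun k => (b k : ℝ)) j = (toricExp U b j : ℝ) := by
    intro b j
    simp [V, toricExp, Matrix.mulVec, dotProduct]
  have hsub : ∀ b ∈ p.support, (fun k => (b k : ℝ)) ∈ newtonPolygon p := fun b hb =>
    subset_convexHull _ _ ⟨b, hb, rfl⟩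
  obtain ⟨a, ha, hax⟩ : ∃ a ∈ p.support,
      ∑ j, (toricExp U a j : ℝ) ≤ ∑ j, (V *ᵥ x) j := by
    by_contra! hcon
    have hlin : IsLinearMap ℝ fun y => ∑ j, (V *ᵥ y) j :=
      ⟨fun y z => by simp [Matrix.mulVec_add, Finset.sum_add_distrib],
        fun c y => by simp [Matrix.mulVec_smul, mul_add]⟩
    have := convexHull_min (s := (fun (a : Fin 2 →₀ ℕ) (j : Fin 2) => (a j : ℝ)) ''
      (p.support : Set (Fin 2 →₀ ℕ))) (t := {y | ∑ j, (V *ᵥ x) j < ∑ j, (V *ᵥ y) j}) (by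
        rintro _ ⟨b, hb, rfl⟩
        simpa only [Set.mem_ofPred_eq, hcast] using hcon b hb) (convex_halfSpace_gt hlin _) hx
    exact lt_irrefl (∑ j, (V *ᵥ x) j) this
  have heq : ∀ j, (V *ᵥ x) j = toricExp U a j := by
    have h1 : ∀ j ∈ Finset.univ, (V *ᵥ x) j ≤ toricExp U a j := fun j _ =>
      (hmin _ (hsub a ha) j).trans_eq (hcast a j)
    intro j
    exact (Finset.sum_eq_sum_iff_of_le h1).1 (le_antisymm (Finset.sum_le_sum h1) hax) j
      (Finset.mem_univ j)
  refine ⟨a, ha, fun b hb j => ?_⟩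
  have := hmin _ (hsub b hb) j
  rw [hcast, heq] at this
  exact_mod_cast this

/-- Each of the supports has a point at which the two coordinates of a `Γ`-toric transformation are
both smallest. -/
theorem exists_toricExp_eq_minExp {f : Fin 2 → MvPolynomial (Fin 2) ℂ} {Γ : Set (Fin 2 → ℝ)}
    {U : Matrix (Fin 2) (Fin 2) ℤ} (hΓ : Γ ⊆ newtonSum f)
    (hU : U ∈ toricTransformations (newtonSum f) Γ) (i : Fin 2) :
    ∃ a ∈ (f i).support, ∀ j, toricExp U a j = minExp U (f i) j := by
  obtain ⟨_, ⟨x₀, hx₀, x₁, hx₁, rfl⟩, hmin⟩ := exists_forall_mulVec_le hΓ hU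
  suffices ∃ x ∈ newtonPolygon (f i), ∀ y ∈ newtonPolygon (f i), ∀ j,
      (U.map (Int.cast : ℤ → ℝ) *ᵥ x) j ≤ (U.map (Int.cast : ℤ → ℝ) *ᵥ y) j by
    obtain ⟨x, hx, hx'⟩ := this
    obtain ⟨a, ha, hle⟩ := exists_mem_support_forall_toricExp_le hx hx'
    refine ⟨a, ha, fun j => Eq.symm (IsLeast.csInf_eq (⟨⟨a, ha, rfl⟩, ?_⟩ :
      IsLeast ((fun a => toricExp U a j) '' ((f i).support : Set (Fin 2 →₀ ℕ))) _))⟩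
    rintro _ ⟨b, hb, rfl⟩
    exact hle b hb j
  simp only [Matrix.mulVec_add] at hmin
  fin_cases i
  · refine ⟨x₀, hx₀, fun y hy j => ?_⟩
    have := hmin _ (Set.add_mem_add hy hx₁) j
    rw [Matrix.mulVec_add] at this
    exact le_of_add_le_add_right this
  · refine ⟨x₁, hx₁, fun y hy j => ?_⟩
    have := hmin _ (Set.add_mem_add hx₀ hy) j
    rw [Matrix.mulVec_add] at this
    exact le_of_add_le_add_left this

/-- `U` is injective, so `a` is the only support exponent sent to `0` and nothing can cancel its
coefficient. -/
theorem eval_zero_toricTransform_ne_zero {U : Matrix (Fin 2) (Fin 2) ℤ}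
    {p : MvPolynomial (Fin 2) ℂ} (hU : IsUnit U.det) {a : Fin 2 →₀ ℕ} (ha : a ∈ p.support)
    (hmin : ∀ j, toricExp U a j = minExp U p j) : eval 0 (toricTransform U p 0) ≠ 0 := by
  have hle : ∀ b ∈ p.support, ∀ j, minExp U p j ≤ toricExp U b j := fun b hb j =>
    csInf_le ((Finset.finite_toSet _).image _).bddBelow ⟨b, hb, rfl⟩
  have hexp : clearedExp U p a = 0 := by
    ext j
    simp [clearedExp, hmin]
  have hne : ∀ b ∈ p.support, b ≠ a → clearedExp U p b ≠ 0 := by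
    intro b hb hba h
    refine hba (toricExp_injective hU (funext fun j => ?_))
    have h2 := DFunLike.congr_fun h j
    simp only [clearedExp, Finsupp.equivFunOnFinite_symm_apply_apply, Finsupp.coe_zero,
      Pi.zero_apply, Int.toNat_eq_zero, sub_nonpos] at h2
    rw [hmin]
    exact le_antisymm h2 (hle b hb j)
  have : toricTransform U p 0 = ∑ a ∈ p.support, monomial (clearedExp U p a) (coeff a p) := by
    simp only [toricTransform, C_0, sub_zero, clearedExp]
  rw [this, map_sum, Finset.sum_eq_single a]
  · rw [hexp, MvPolynomial.eval_zero, constantCoeff_monomial, if_pos rfl]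
    exact mem_support_iff.1 ha
  · intro b hb hba
    rw [MvPolynomial.eval_zero, constantCoeff_monomial, if_neg (hne b hb hba)]
  · exact fun h => absurd ha h

/-! ### The non-vanishing case and the conclusion. -/

/-- If the monomials of the pencil do not vanish at `(ρ, 0)`, exactly one of its members does. -/
theorem closure_limit_eq_multiplicity_jump_of_forall_eq_zero
    {G : Fin 2 → MvPolynomial (Fin 2) ℂ} {M : Fin 2 → Fin 2 →₀ ℕ} {ρ : ℂ}
    (hM : ∀ i, M i 1 = 0) (hρM : ∀ i, ρ ^ M i 0 ≠ 0) :
    closure {y : Fin 2 → ℂ | (∀ k, eval ![ρ, 0] (pencil G M y k) = 0) ∧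
      ∃ (z : ℕ → Fin 2 → ℂ) (q : ℕ → Fin 2 → ℂ),
        (∀ k l, z k l ≠ 0) ∧ Tendsto z atTop (𝓝 ![ρ, 0]) ∧ Tendsto q atTop (𝓝 y) ∧
          ∀ k l, eval (z k) (pencil G M (q k) l) = 0} =
    {y | ∃ q, multiplicityAt (pencil G M q) ![ρ, 0] < multiplicityAt (pencil G M y) ![ρ, 0]} := by
  have heval : ∀ y z i, eval z (pencil G M y i) = eval z (G i) - y i * z 0 ^ M i 0 := by
    intro y z i
    rw [eval_pencil, hM, pow_zero, mul_one]
  set y₀ : Fin 2 → ℂ := fun i => eval ![ρ, 0] (G i) / ρ ^ M i 0 with hy₀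
  have hsol : ∀ y, (∀ k, eval ![ρ, 0] (pencil G M y k) = 0) ↔ y = y₀ := by
    intro y
    simp only [heval, Matrix.cons_val_zero, sub_eq_zero, funext_iff, hy₀, eq_div_iff (hρM _)]
    exact forall_congr' fun _ => eq_comm
  have hright : {y | ∃ q, multiplicityAt (pencil G M q) ![ρ, 0] <
      multiplicityAt (pencil G M y) ![ρ, 0]} = {y₀} := by
    ext y
    rw [Set.mem_ofPred_eq, Set.mem_singleton_iff, ← hsol]
    constructor
    · rintro ⟨q, hq⟩ k
      by_contra hk
      rw [multiplicityAt_eq_zero hk] at hq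
      exact not_lt_zero hq
    · intro h
      have hne : ¬ ∀ k, eval ![ρ, 0] (pencil G M (y₀ + 1) k) = 0 := by
        rw [hsol]
        simp
      push Not at hne
      obtain ⟨k, hk⟩ := hne
      refine ⟨y₀ + 1, ?_⟩
      rw [multiplicityAt_eq_zero hk]
      exact pos_iff_ne_zero.2 (multiplicityAt_ne_zero h)
  rw [hright]
  refine (congrArg closure ?_).trans closure_singleton
  ext y
  rw [Set.mem_ofPred_eq, Set.mem_singleton_iff, hsol, and_iff_left_iff_imp]
  rintro rfl
  -- A perturbation keeping the first coordinate off `0`; it is needed only when `ρ = 0`.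
  obtain ⟨δ, hδ⟩ : ∃ δ : ℂ, ∀ k : ℕ, ρ + δ * (1 / ((k : ℂ) + 1)) ≠ 0 := by
    by_cases h : ρ = 0
    · exact ⟨1, fun k => by rw [h, zero_add, one_mul]; exact one_div_ne_zero k.cast_add_one_ne_zero⟩
    · exact ⟨0, fun k => by rwa [zero_mul, add_zero]⟩
  have hlim : Tendsto (fun k : ℕ => 1 / ((k : ℂ) + 1)) atTop (𝓝 0) :=
    tendsto_one_div_add_atTop_nhds_zero_nat
  set z : ℕ → Fin 2 → ℂ := fun k => ![ρ + δ * (1 / ((k : ℂ) + 1)), 1 / ((k : ℂ) + 1)] with hz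
  have hz0 : ∀ k l, z k l ≠ 0 := by
    intro k l
    fin_cases l
    · exact hδ k
    · exact one_div_ne_zero k.cast_add_one_ne_zero
  have hzt : Tendsto z atTop (𝓝 ![ρ, 0]) := by
    rw [tendsto_pi_nhds]
    intro l
    fin_cases l
    · simpa [hz] using (hlim.const_mul δ).const_add ρ
    · simpa [hz] using hlim
  -- For each point of the torus the equations are solved for `y`; the values converge because the
  -- denominators tend to `ρ ^ M i 0 ≠ 0`.
  refine ⟨z, fun k i => eval (z k) (G i) / z k 0 ^ M i 0, hz0, hzt, ?_, fun k i => ?_⟩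
  · rw [tendsto_pi_nhds]
    intro i
    exact (((MvPolynomial.continuous_eval (G i)).tendsto _).comp hzt).div
      (((tendsto_pi_nhds.1 hzt) 0).pow _) (hρM i)
  · rw [heval, div_mul_cancel₀ _ (pow_ne_zero _ (hz0 k 0)), sub_self]

end

theorem mainTheorem4 (f : Fin 2 → MvPolynomial (Fin 2) ℂ)
    (hdom : IsDominant f) (h0 : ∀ i, MvPolynomial.eval 0 (f i) ≠ 0)
    (Γ : Set (Fin 2 → ℝ)) (hΓ : IsEdge Γ (newtonSum f))
    (U : Matrix (Fin 2) (Fin 2) ℤ) (hU : U ∈ toricTransformations (newtonSum f) Γ)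
    (ρ : ℂ) (hρ : ρ ∈ faceSol f U) :
    topFaceMult f U ρ = algFaceMult f U ρ := by
  set G : Fin 2 → MvPolynomial (Fin 2) ℂ := fun i => toricTransform U (f i) 0
  set M : Fin 2 → Fin 2 →₀ ℕ := fun i => clearedExp U (f i) 0
  have hpencil : ∀ y, (fun i => toricTransform U (f i) (y i)) = pencil G M y := fun y =>
    funext fun i => toricTransform_eq_pencil h0 y i
  have hΓA : Γ ⊆ newtonSum f := by
    obtain ⟨⟨α, -, rfl⟩, -⟩ := hΓ
    exact Set.sep_subset _ _
  have hG0 : ∀ i, eval 0 (G i) ≠ 0 := by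
    intro i
    obtain ⟨a, ha, hmin⟩ := exists_toricExp_eq_minExp hΓA hU i
    exact eval_zero_toricTransform_ne_zero (isUnit_det_of_mem_toricTransformations hU) ha hmin
  have hzero : (![0, 0] : Fin 2 → ℂ) = 0 := by simp
  obtain ⟨y₀, hy₀⟩ := hρ
  have hsol : ∀ y z, IsSol f U y z ↔ ∀ k, eval z (pencil G M y k) = 0 := fun y z => by
    rw [← hpencil]
    rfl
  rw [hsol] at hy₀
  simp only [topFaceMult, algFaceMult, faceMultiplicity, hpencil, hsol]
  by_cases hM : ∀ i, M i 1 = 0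
  -- If `ρ ^ M i 0 = 0`, then `ρ = 0` and the `i`-th equation would make the constant term of `G i`
  -- vanish.
  · refine closure_limit_eq_multiplicity_jump_of_forall_eq_zero hM fun i h => ?_
    obtain ⟨rfl, h2⟩ := pow_eq_zero_iff'.1 h
    have := hy₀ i
    rw [eval_pencil, Matrix.cons_val_zero, h, zero_mul, mul_zero, sub_zero, hzero] at this
    exact hG0 i this
  · push Not at hM
    obtain ⟨i, hi⟩ := hM
    obtain ⟨j, hij⟩ : ∃ j, i ≠ j := (exists_ne i).imp fun _ => Ne.symm
    have hs : eval ![ρ, 0] (G i) = 0 := by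
      have := hy₀ i
      rwa [eval_pencil, Matrix.cons_val_one, Matrix.cons_val_fin_one, zero_pow hi, mul_zero, mul_zero,
        sub_zero] at this
    refine closure_limit_eq_multiplicity_jump hij hi ?_ (fun h => hG0 i ?_) hs
    · rintro rfl
      exact hG0 i (hzero ▸ hs)
    -- At `s = -ρ` the restriction of `G i` to `z 1 = 0` takes the value of `G i` at the origin,
    -- which is non-zero.
    · have := eval_shiftEquiv ρ (-ρ) 0 (G i)
      rw [h, Polynomial.eval_zero, neg_add_cancel, hzero] at this
      exact this.symm
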